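/- Let $E=(E^0,E^1,s,r)$ be an arbitrary directed graph and let $S$ be an additively idempotent commutative semiring (so $1\neq 0$ and $a+a=a$ for all $a\in S$). Call $v\in E^0$ a sink if $s^{-1}(v)=\varnothing$, an infinite emitter if $s^{-1}(v)$ is infinite, and regular otherwise. Let $E^*$ be the set of finite paths (the vertices being the paths of length $0$), and let $X_E$ be the set of all infinite paths together with all finite paths $p$ such that $r(p)$ is a sink or an infinite emitter. The graph groupoid is $$\mathcal G_E=\{(\alpha x,|\alpha|-|\beta|,\beta x)\mid \alpha,\beta\in E^*,\ x\in X_E,\ r(\alpha)=s(x)=r(\beta)\},$$ with $(x,k,y)(y,l,z)=(x,k+l,z)$ and $(x,k,y)^{-1}=(y,-k,x)$; the arrow $(x,k,y)$ has range $(x,0,x)$ and source $(y,0,y)$. It carries the topology with base the sets $$Z(\alpha,\beta,F)=Z(\alpha,\beta)\setminus\bigcup_{e\in F}Z(\alpha e,\beta e),\qquad Z(\alpha,\beta)=\{(\alpha x,|\alpha|-|\beta|,\beta x)\mid x\in X_E,\ s(x)=r(\alpha)\},$$ for $\alpha,\beta\in E^*$ with $r(\alpha)=r(\beta)$ and $F\subseteq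 s^{-1}(r(\alpha))$ finite. The Steinberg algebra $A_S(\mathcal G_E)$ is the $S$-semimodule spanned by the characteristic functions $1_U\colon\mathcal G_E\to S$ of the compact open bisections $U$ of $\mathcal G_E$, with the convolution product $(f*g)(\gamma)=\sum_{\alpha\beta=\gamma}f(\alpha)g(\beta)$. The Leavitt path algebra $L_S(E)$ is the (associative, not necessarily unital) $S$-algebra generated by $\{v\mid v\in E^0\}\cup\{e,e^*\mid e\in E^1\}$ subject to the relations: $vw=\delta_{v,w}v$ for $v,w\in E^0$; $s(e)e=e=e\,r(e)$ and $r(e)e^*=e^*=e^*s(e)$ for $e\in E^1$; $e^*f=\delta_{e,f}\,r(e)$ for $e,f\in E^1$; and $v=\sum_{e\in s^{-1}(v)}ee^*$ for every regular vertex $v$. Let $\pi_E\colon L_S(E)\to A_S(\mathcal G_E)$ be the natural homomorphism, i.e. the unique $S$-algebra homomorphism with $\pi_E(v)=1_{Z(v,v)}$, $\pi_E(e)=1_{Z(e,r(e))}$ and $\pi_E(e^*)=1_{Z(r(e),e)}$ for all $v\in E^0$, $e\in E^1$. Then $\pi_E$ is surjective if and only if $E$ is row-finite, i.e. $s^{-1}(v)$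 is finite for every $v\in E^0$. -/

import Mathlib

namespace GraphAlg

universe u v w

/-- A directed graph with vertex set `V`, edge set `Ed` and source and range maps. -/
structure DirectedGraph (V : Type u) (Ed : Type v) where
  src : Ed → V
  rng : Ed → V

/-- Finite (`fin l`) or infinite (`inf f`) sequences of edges. -/
inductive EdgeSeq (Ed : Type v) where
  | fin (l : List Ed) : EdgeSeq Ed
  | inf (f : ℕ → Ed) : EdgeSeq Ed

namespace EdgeSeq

variable {Ed : Type v}

/-- Put one edge in front of a sequence. -/
def cons (e : Ed) : EdgeSeq Ed → EdgeSeq Ed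
  | fin l => fin (e :: l)
  | inf f => inf fun n => Nat.casesOn n e f

/-- Put a finite sequence in front of a finite or infinite one. -/
def prepend (l : List Ed) (t : EdgeSeq Ed) : EdgeSeq Ed := l.foldr cons t

@[simp] theorem prepend_nil (t : EdgeSeq Ed) : prepend [] t = t := rfl

@[simp] theorem prepend_cons (e : Ed) (l : List Ed) (t : EdgeSeq Ed) :
    prepend (e :: l) t = cons e (prepend l t) := rfl

theorem prepend_append (l m : List Ed) (t : EdgeSeq Ed) :
    prepend (l ++ m) t = prepend l (prepend m t) := by
  simp [prepend]

theorem cons_inj {e e' : Ed} {t t' : EdgeSeq Ed} (h : cons e t = cons e' t') :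
    e = e' ∧ t = t' := by
  cases t <;> cases t' <;> simp only [cons, fin.injEq, inf.injEq, reduceCtorEq] at h ⊢
  · simpa using h
  · exact ⟨congrFun h 0, funext fun n => congrFun h (n + 1)⟩

theorem cons_ne_nil (e : Ed) (t : EdgeSeq Ed) : cons e t ≠ fin [] := by
  cases t <;> simp [cons]

theorem eq_nil_or_cons (t : EdgeSeq Ed) : t = fin [] ∨ ∃ e t', t = cons e t' := by
  cases t with
  | fin l =>
    cases l with
    | nil => exact Or.inl rfl
    | cons e l => exact Or.inr ⟨e, fin l, rfl⟩
  | inf f =>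
    refine Or.inr ⟨f 0, inf fun n => f (n + 1), ?_⟩
    simp only [cons, inf.injEq]
    funext n
    cases n <;> rfl

theorem prepend_inj (l : List Ed) {t t' : EdgeSeq Ed} (h : prepend l t = prepend l t') :
    t = t' := by
  induction l with
  | nil => exact h
  | cons e l ih => exact ih (cons_inj h).2

theorem prepend_inj_of_length {l l' : List Ed} {t t' : EdgeSeq Ed} (hl : l.length = l'.length)
    (h : prepend l t = prepend l' t') : l = l' ∧ t = t' := by
  induction l generalizing l' with
  | nil =>
    cases l' with
    | nil => exact ⟨rfl, h⟩
    | cons e l' => simp at hl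
  | cons e l ih =>
    cases l' with
    | nil => simp at hl
    | cons e' l' =>
      obtain ⟨h1, h2⟩ := cons_inj h
      obtain ⟨h3, h4⟩ := ih (by simpa using hl) h2
      exact ⟨by rw [h1, h3], h4⟩

theorem prepend_eq_prepend {b c : List Ed} {t t' : EdgeSeq Ed} (h : prepend b t = prepend c t') :
    (∃ m, c = b ++ m ∧ t = prepend m t') ∨ (∃ m, b = c ++ m ∧ t' = prepend m t) := by
  induction b generalizing c with
  | nil => exact Or.inl ⟨c, rfl, h⟩
  | cons e b ih =>
    cases c with
    | nil => exact Or.inr ⟨e :: b, rfl, h.symm⟩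
    | cons e' c =>
      obtain ⟨rfl, h2⟩ := cons_inj h
      rcases ih h2 with ⟨m, rfl, rfl⟩ | ⟨m, rfl, rfl⟩
      · exact Or.inl ⟨m, rfl, rfl⟩
      · exact Or.inr ⟨m, rfl, rfl⟩

end EdgeSeq

open EdgeSeq

namespace DirectedGraph

variable {V : Type u} {Ed : Type v} (E : DirectedGraph V Ed)

/-- The edges emitted by `v`. -/
def out (v : V) : Set Ed := {e | E.src e = v}

/-- Every vertex emits only finitely many edges. -/
def RowFinite : Prop := ∀ v, (E.out v).Finite

def IsSink (v : V) : Prop := E.out v = ∅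

def IsInfiniteEmitter (v : V) : Prop := (E.out v).Infinite

def IsRegular (v : V) : Prop := (E.out v).Nonempty ∧ (E.out v).Finite

/-- `l` is a list of consecutive edges, the first of which (if any) starts at `v`. -/
def IsWalk (v : V) : List Ed → Prop
  | [] => True
  | e :: l => E.src e = v ∧ IsWalk (E.rng e) l

/-- The vertex where a walk that starts at `v` ends. -/
def walkEnd (v : V) : List Ed → V
  | [] => v
  | e :: l => walkEnd (E.rng e) l

/-- `t` is a finite walk from `v` to a sink or an infinite emitter, or an infinite walk
from `v`. -/
def IsBoundary (v : V) : EdgeSeq Ed → Prop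
  | fin l => E.IsWalk v l ∧ (E.IsSink (E.walkEnd v l) ∨ E.IsInfiniteEmitter (E.walkEnd v l))
  | inf f => E.src (f 0) = v ∧ ∀ i, E.rng (f i) = E.src (f (i + 1))

variable {E}

theorem isWalk_append {v : V} {l m : List Ed} :
    E.IsWalk v (l ++ m) ↔ E.IsWalk v l ∧ E.IsWalk (E.walkEnd v l) m := by
  induction l generalizing v with
  | nil => simp [IsWalk, walkEnd]
  | cons e l ih => simp [IsWalk, walkEnd, ih, and_assoc]

theorem walkEnd_append {v : V} {l m : List Ed} :
    E.walkEnd v (l ++ m) = E.walkEnd (E.walkEnd v l) m := by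
  induction l generalizing v with
  | nil => simp [walkEnd]
  | cons e l ih => simp [walkEnd, ih]

theorem isBoundary_cons {v : V} {e : Ed} {t : EdgeSeq Ed} :
    E.IsBoundary v (cons e t) ↔ E.src e = v ∧ E.IsBoundary (E.rng e) t := by
  cases t with
  | fin l => simp [IsBoundary, cons, IsWalk, walkEnd, and_assoc]
  | inf f =>
    simp only [IsBoundary, cons]
    constructor
    · rintro ⟨h0, h⟩
      exact ⟨h0, (h 0).symm, fun i => h (i + 1)⟩
    · rintro ⟨h0, h1, h⟩
      refine ⟨h0, fun i => ?_⟩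
      cases i with
      | zero => exact h1.symm
      | succ i => exact h i

theorem isBoundary_prepend {v : V} {l : List Ed} {t : EdgeSeq Ed} :
    E.IsBoundary v (prepend l t) ↔ E.IsWalk v l ∧ E.IsBoundary (E.walkEnd v l) t := by
  induction l generalizing v with
  | nil => simp [IsWalk, walkEnd]
  | cons e l ih => simp [IsWalk, walkEnd, ih, isBoundary_cons, and_assoc]

variable (E)

/-- Finite paths, including the vertices (the paths with no edges). -/
@[ext] structure FinPath where
  start : V
  edges : List Ed
  isWalk : E.IsWalk start edges

/-- The elements of `X_E`: finite paths that end in a sink or an infinite emitter,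
and infinite paths. -/
@[ext] structure BoundaryPath where
  start : V
  seq : EdgeSeq Ed
  isBoundary : E.IsBoundary start seq

variable {E}

namespace FinPath

def range (α : E.FinPath) : V := E.walkEnd α.start α.edges

def length (α : E.FinPath) : ℕ := α.edges.length

/-- A vertex as a path of length zero. -/
def vertex (E : DirectedGraph V Ed) (v : V) : E.FinPath := ⟨v, [], trivial⟩

/-- An edge as a path of length one. -/
def edge (E : DirectedGraph V Ed) (e : Ed) : E.FinPath := ⟨E.src e, [e], rfl, trivial⟩

/-- The path `α m`, for a walk `m` from the range of `α`. -/
def append (α : E.FinPath) (m : List Ed) (h : E.IsWalk α.range m) : E.FinPath :=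
  ⟨α.start, α.edges ++ m, isWalk_append.2 ⟨α.isWalk, h⟩⟩

/-- The path `α e`. -/
def snoc (α : E.FinPath) (e : Ed) (h : E.src e = α.range) : E.FinPath :=
  α.append [e] ⟨h, trivial⟩

/-- The boundary path `α x`. -/
def concat (α : E.FinPath) (x : E.BoundaryPath) (h : α.range = x.start) : E.BoundaryPath :=
  ⟨α.start, prepend α.edges x.seq, isBoundary_prepend.2 ⟨α.isWalk, by
    have := x.isBoundary
    rw [← h] at this
    exact this⟩⟩

theorem range_append (α : E.FinPath) (m : List Ed) (h : E.IsWalk α.range m) :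
    (α.append m h).range = E.walkEnd α.range m := walkEnd_append

theorem range_snoc (α : E.FinPath) (e : Ed) (h : E.src e = α.range) :
    (α.snoc e h).range = E.rng e := range_append α [e] _

end FinPath

variable (E)

/-- The graph groupoid: the triples `(α x, |α| - |β|, β x)`; an arrow `(x, k, y)` has range `x`
and source `y`. -/
@[ext] structure Groupoid where
  rng : E.BoundaryPath
  deg : ℤ
  src : E.BoundaryPath
  spec : ∃ (α β : E.FinPath) (x : E.BoundaryPath) (hα : α.range = x.start)
    (hβ : β.range = x.start),
    rng = α.concat x hα ∧ deg = (α.length : ℤ) - β.length ∧ src = β.concat x hβ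

variable {E}

/-- A description of arrows by edge sequences only. -/
theorem Groupoid.spec_iff {x y : E.BoundaryPath} {k : ℤ} :
    (∃ (α β : E.FinPath) (z : E.BoundaryPath) (hα : α.range = z.start) (hβ : β.range = z.start),
      x = α.concat z hα ∧ k = (α.length : ℤ) - β.length ∧ y = β.concat z hβ) ↔
    ∃ (a b : List Ed) (t : EdgeSeq Ed), E.walkEnd x.start a = E.walkEnd y.start b ∧
      x.seq = prepend a t ∧ k = (a.length : ℤ) - b.length ∧ y.seq = prepend b t := by
  constructor
  · rintro ⟨α, β, z, hα, hβ, rfl, rfl, rfl⟩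
    exact ⟨α.edges, β.edges, z.seq, hα.trans hβ.symm, rfl, rfl, rfl⟩
  · rintro ⟨a, b, t, h, h1, rfl, h2⟩
    have hx := x.isBoundary
    have hy := y.isBoundary
    rw [h1, isBoundary_prepend] at hx
    rw [h2, isBoundary_prepend] at hy
    refine ⟨⟨x.start, a, hx.1⟩, ⟨y.start, b, hy.1⟩, ⟨_, t, hx.2⟩, rfl, h.symm, ?_, rfl, ?_⟩
    · ext1
      · rfl
      · exact h1
    · ext1
      · rfl
      · exact h2

namespace Groupoid

/-- `(x, k, y)⁻¹ = (y, -k, x)`. -/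
def inv (g : E.Groupoid) : E.Groupoid where
  rng := g.src
  deg := -g.deg
  src := g.rng
  spec := by
    obtain ⟨α, β, x, hα, hβ, h1, h2, h3⟩ := g.spec
    exact ⟨β, α, x, hβ, hα, h3, by rw [h2]; ring, h1⟩

/-- `(x, k, y) (y, l, z) = (x, k + l, z)`. -/
def comp (g h : E.Groupoid) (hgh : g.src = h.rng) : E.Groupoid where
  rng := g.rng
  deg := g.deg + h.deg
  src := h.src
  spec := by
    obtain ⟨a, b, t, e1, h1, h2, h3⟩ := spec_iff.1 g.spec
    obtain ⟨c, d, t', e1', h1', h2', h3'⟩ := spec_iff.1 h.spec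
    apply spec_iff.2
    rw [hgh] at h3 e1
    rcases prepend_eq_prepend (h3.symm.trans h1') with ⟨m, rfl, rfl⟩ | ⟨m, rfl, rfl⟩
    · refine ⟨a ++ m, d, t', ?_, ?_, ?_, h3'⟩
      · rw [walkEnd_append, e1, ← walkEnd_append, e1']
      · rw [h1, prepend_append]
      · rw [h2, h2']; push_cast [List.length_append]; ring
    · refine ⟨a, d ++ m, t, ?_, h1, ?_, ?_⟩
      · rw [e1, walkEnd_append, e1', ← walkEnd_append]
      · rw [h2, h2']; push_cast [List.length_append]; ring
      · rw [h3', prepend_append]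

/-- The unit `(x, 0, x)`. -/
def unit (x : E.BoundaryPath) : E.Groupoid where
  rng := x
  deg := 0
  src := x
  spec := by
    exact spec_iff.2 ⟨[], [], x.seq, rfl, rfl, by simp, rfl⟩

/-- The set of units `(x, 0, x)`. -/
def units (E : DirectedGraph V Ed) : Set E.Groupoid := Set.range unit

/-- The source map `(x, k, y) ↦ (y, 0, y)`, with values in the unit space. -/
def sourceMap (g : E.Groupoid) : units E := ⟨unit g.src, g.src, rfl⟩

/-- The range map `(x, k, y) ↦ (x, 0, x)`, with values in the unit space. -/
def rangeMap (g : E.Groupoid) : units E := ⟨unit g.rng, g.rng, rfl⟩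

theorem unit_injective : Function.Injective (unit : E.BoundaryPath → E.Groupoid) :=
  fun _ _ h => congrArg Groupoid.rng h

theorem sourceMap_eq_iff {g h : E.Groupoid} : sourceMap g = sourceMap h ↔ g.src = h.src :=
  Subtype.ext_iff.trans unit_injective.eq_iff

theorem rangeMap_eq_iff {g h : E.Groupoid} : rangeMap g = rangeMap h ↔ g.rng = h.rng :=
  Subtype.ext_iff.trans unit_injective.eq_iff

end Groupoid

/-- `U V = {α β | α ∈ U, β ∈ V, r(β) = s(α)}`. -/
def setMul (U W : Set E.Groupoid) : Set E.Groupoid :=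
  {g | ∃ a ∈ U, ∃ b ∈ W, ∃ h : a.src = b.rng, a.comp b h = g}

/-- `U⁻¹`. -/
def setInv (U : Set E.Groupoid) : Set E.Groupoid := {g | g.inv ∈ U}

/-- `Z(α, β)`. -/
def Z (α β : E.FinPath) : Set E.Groupoid :=
  {g | ∃ (x : E.BoundaryPath) (hα : α.range = x.start) (hβ : β.range = x.start),
    g.rng = α.concat x hα ∧ g.deg = (α.length : ℤ) - β.length ∧ g.src = β.concat x hβ}

/-- `Z(α, β, F) = Z(α, β) \ ⋃ e ∈ F, Z(α e, β e)`. -/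
def ZF (α β : E.FinPath) (F : Finset Ed) : Set E.Groupoid :=
  Z α β \ {g | ∃ e ∈ F, ∃ (hα : E.src e = α.range) (hβ : E.src e = β.range),
    g ∈ Z (α.snoc e hα) (β.snoc e hβ)}

variable (E) in
/-- The sets `Z(α, β, F)` with `r(α) = r(β)` and `F` a finite set of edges emitted
by `r(α)`. -/
def basicSets : Set (Set E.Groupoid) :=
  {U | ∃ (α β : E.FinPath) (F : Finset Ed), α.range = β.range ∧ (↑F : Set Ed) ⊆ E.out α.range ∧
    U = ZF α β F}

/-- The topology of the graph groupoid. -/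
instance Groupoid.topology : TopologicalSpace E.Groupoid :=
  TopologicalSpace.generateFrom (basicSets E)

/-- Compact open bisections: compact open sets on which the source and the range map are
homeomorphisms onto open subsets of the unit space. -/
structure IsCompactOpenBisection (U : Set E.Groupoid) : Prop where
  isCompact : IsCompact U
  isOpen : IsOpen U
  source : Topology.IsOpenEmbedding fun g : U => Groupoid.sourceMap (g : E.Groupoid)
  range : Topology.IsOpenEmbedding fun g : U => Groupoid.rangeMap (g : E.Groupoid)

/-! ### Helper facts: the topology of the graph groupoid -/

namespace Groupoid

/-- The arrow `(α t, |α| - |β|, β t)`. -/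
def arrow (α β : E.FinPath) (h : α.range = β.range) (t : EdgeSeq Ed)
    (ht : E.IsBoundary α.range t) : E.Groupoid :=
  ⟨α.concat ⟨α.range, t, ht⟩ rfl, (α.length : ℤ) - β.length, β.concat ⟨α.range, t, ht⟩ h.symm,
    α, β, ⟨α.range, t, ht⟩, rfl, h.symm, rfl, rfl, rfl⟩

end Groupoid

open Groupoid

/-- `t` is the common tail that exhibits `g` as an element of `Z(α, β)`. -/
structure IsTail (α β : E.FinPath) (g : E.Groupoid) (t : EdgeSeq Ed) : Prop where
  rs : g.rng.start = α.start
  ss : g.src.start = β.start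
  re : g.rng.seq = prepend α.edges t
  se : g.src.seq = prepend β.edges t
  dg : g.deg = (α.length : ℤ) - β.length

theorem isTail_arrow {α β : E.FinPath} (h : α.range = β.range) {t : EdgeSeq Ed}
    (ht : E.IsBoundary α.range t) : IsTail α β (arrow α β h t ht) t :=
  ⟨rfl, rfl, rfl, rfl, rfl⟩

theorem IsTail.isBoundary {α β : E.FinPath} {g : E.Groupoid} {t : EdgeSeq Ed}
    (h : IsTail α β g t) : E.IsBoundary α.range t := by
  have := g.rng.isBoundary
  rw [h.re, h.rs, isBoundary_prepend] at this
  exact this.2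

theorem IsTail.isBoundary' {α β : E.FinPath} {g : E.Groupoid} {t : EdgeSeq Ed}
    (h : IsTail α β g t) : E.IsBoundary β.range t := by
  have := g.src.isBoundary
  rw [h.se, h.ss, isBoundary_prepend] at this
  exact this.2

theorem IsTail.inv {α β : E.FinPath} {g : E.Groupoid} {t : EdgeSeq Ed}
    (h : IsTail α β g t) : IsTail β α g.inv t :=
  ⟨h.ss, h.rs, h.se, h.re, by simp [Groupoid.inv, h.dg]⟩

theorem IsTail.eq {α β : E.FinPath} {g g' : E.Groupoid} {t : EdgeSeq Ed}
    (h : IsTail α β g t) (h' : IsTail α β g' t) : g = g' := by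
  ext1
  · ext1
    · rw [h.rs, h'.rs]
    · rw [h.re, h'.re]
  · rw [h.dg, h'.dg]
  · ext1
    · rw [h.ss, h'.ss]
    · rw [h.se, h'.se]

theorem IsTail.comp {α β δ : E.FinPath} {g g' : E.Groupoid} {t : EdgeSeq Ed}
    (h : IsTail α β g t) (h' : IsTail β δ g' t) (hgg : g.src = g'.rng) :
    IsTail α δ (g.comp g' hgg) t :=
  ⟨h.rs, h'.ss, h.re, h'.se, by simp [Groupoid.comp, h.dg, h'.dg]⟩

theorem IsTail.unique {α β : E.FinPath} {g : E.Groupoid} {t t' : EdgeSeq Ed}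
    (h : IsTail α β g t) (h' : IsTail α β g t') : t = t' :=
  prepend_inj _ (h.re.symm.trans h'.re)

theorem isTail_append {α β : E.FinPath} {g : E.Groupoid} {t : EdgeSeq Ed} {m : List Ed}
    {ha : E.IsWalk α.range m} {hb : E.IsWalk β.range m} :
    IsTail (α.append m ha) (β.append m hb) g t ↔ IsTail α β g (prepend m t) := by
  constructor
  · intro h
    exact ⟨h.rs, h.ss, by rw [h.re, ← prepend_append]; rfl, by rw [h.se, ← prepend_append]; rfl,
      by rw [h.dg]; simp [FinPath.append, FinPath.length]⟩
  · intro h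
    exact ⟨h.rs, h.ss, by rw [h.re, ← prepend_append]; rfl, by rw [h.se, ← prepend_append]; rfl,
      by rw [h.dg]; simp [FinPath.append, FinPath.length]⟩

theorem mem_Z {α β : E.FinPath} {g : E.Groupoid} (h : α.range = β.range) :
    g ∈ Z α β ↔ ∃ t, IsTail α β g t := by
  constructor
  · rintro ⟨x, ha, hb, h1, h2, h3⟩
    exact ⟨x.seq, by rw [h1]; rfl, by rw [h3]; rfl, by rw [h1]; rfl, by rw [h3]; rfl, h2⟩
  · rintro ⟨t, ht⟩
    rw [ht.eq (isTail_arrow h ht.isBoundary)]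
    exact ⟨⟨_, t, ht.isBoundary⟩, rfl, h.symm, rfl, rfl, rfl⟩

theorem mem_ZF {α β : E.FinPath} {F : Finset Ed} {g : E.Groupoid} (h : α.range = β.range) :
    g ∈ ZF α β F ↔ ∃ t, IsTail α β g t ∧ ∀ e ∈ F, ∀ t', t ≠ cons e t' := by
  constructor
  · rintro ⟨h1, h2⟩
    obtain ⟨t, ht⟩ := (mem_Z h).1 h1
    refine ⟨t, ht, ?_⟩
    rintro e he t' rfl
    have hb := (isBoundary_cons.1 ht.isBoundary).1
    refine h2 ⟨e, he, hb, hb.trans h, ?_⟩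
    rw [mem_Z (by rw [FinPath.range_snoc, FinPath.range_snoc])]
    exact ⟨t', isTail_append.2 ht⟩
  · rintro ⟨t, ht, hF⟩
    refine ⟨(mem_Z h).2 ⟨t, ht⟩, ?_⟩
    rintro ⟨e, he, ha, hb, hg⟩
    rw [mem_Z (by rw [FinPath.range_snoc, FinPath.range_snoc])] at hg
    obtain ⟨t', ht'⟩ := hg
    exact hF e he t' (ht.unique (isTail_append.1 ht'))

theorem ZF_empty (α β : E.FinPath) : ZF α β ∅ = Z α β := by
  simp [ZF]

theorem FinPath.eq_append {α β : E.FinPath} {m : List Ed} (hs : β.start = α.start)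
    (he : β.edges = α.edges ++ m) : ∃ hm, β = α.append m hm := by
  refine ⟨?_, ?_⟩
  · have := β.isWalk
    rw [he, hs, isWalk_append] at this
    exact this.2
  · ext1
    · exact hs
    · exact he

theorem range_append_congr {α β : E.FinPath} (h : α.range = β.range) {m : List Ed}
    {ha : E.IsWalk α.range m} {hb : E.IsWalk β.range m} :
    (α.append m ha).range = (β.append m hb).range := by
  rw [FinPath.range_append, FinPath.range_append, h]

open Classical in
theorem mul_aligned {α β δ : E.FinPath} (h : α.range = β.range) (h' : β.range = δ.range)
    (F F' : Finset Ed) : setMul (ZF α β F) (ZF β δ F') = ZF α δ (F ∪ F') := by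
  ext g
  rw [mem_ZF (h.trans h')]
  constructor
  · rintro ⟨a, ha, b, hb, hab, rfl⟩
    obtain ⟨t, ht, hF⟩ := (mem_ZF h).1 ha
    obtain ⟨t', ht', hF'⟩ := (mem_ZF h').1 hb
    have : t = t' := prepend_inj β.edges (by rw [← ht.se, hab, ht'.re])
    subst this
    refine ⟨t, ht.comp ht' hab, fun e he => ?_⟩
    rcases Finset.mem_union.1 he with he | he
    · exact hF e he
    · exact hF' e he
  · rintro ⟨t, ht, hF⟩
    have hb := ht.isBoundary
    have hb' := hb
    rw [h] at hb'
    have t1 := isTail_arrow h hb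
    have t2 := isTail_arrow h' hb'
    have hc : (arrow α β h t hb).src = (arrow β δ h' t hb').rng := by
      ext1
      · rfl
      · rfl
    refine ⟨_, (mem_ZF h).2 ⟨t, t1, fun e he => hF e (Finset.mem_union_left _ he)⟩, _,
      (mem_ZF h').2 ⟨t, t2, fun e he => hF e (Finset.mem_union_right _ he)⟩, hc, ?_⟩
    exact (t1.comp t2 hc).eq ht

/-- `F` if `m` is empty, and the empty set otherwise. -/
def restFilter (F : Finset Ed) : List Ed → Finset Ed
  | [] => F
  | _ :: _ => ∅

theorem restFilter_subset (F : Finset Ed) (m : List Ed) : restFilter F m ⊆ F := by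
  cases m <;> simp [restFilter]

/-- `Z(α, β, F)` cut down to the tails that start with `m`. -/
theorem mem_refine {α β : E.FinPath} (h : α.range = β.range) {F : Finset Ed} {m : List Ed}
    {ha : E.IsWalk α.range m} {hb : E.IsWalk β.range m} {g : E.Groupoid}
    (hm : ∀ e ∈ F, m.head? ≠ some e) :
    g ∈ ZF (α.append m ha) (β.append m hb) (restFilter F m) ↔
      g ∈ ZF α β F ∧ ∃ t, IsTail α β g (prepend m t) := by
  rw [mem_ZF (range_append_congr h), mem_ZF h]
  constructor
  · rintro ⟨t, ht, hF⟩
    rw [isTail_append] at ht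
    refine ⟨⟨_, ht, ?_⟩, t, ht⟩
    cases m with
    | nil => exact hF
    | cons e' m =>
      intro e he t' h'
      obtain ⟨rfl, -⟩ := cons_inj h'
      exact hm _ he rfl
  · rintro ⟨⟨t, ht, hF⟩, t', ht'⟩
    refine ⟨t', isTail_append.2 ht', ?_⟩
    cases m with
    | nil =>
      obtain rfl : t = t' := ht.unique ht'
      exact hF
    | cons e m => simp [restFilter]

theorem setInv_ZF {α β : E.FinPath} (h : α.range = β.range) (F : Finset Ed) :
    setInv (ZF α β F) = ZF β α F := by
  ext g
  change g.inv ∈ ZF α β F ↔ _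
  rw [mem_ZF h, mem_ZF h.symm]
  constructor
  · rintro ⟨t, ht, hF⟩
    have := ht.inv
    refine ⟨t, ⟨this.rs, this.ss, this.re, this.se, ?_⟩, hF⟩
    have := this.dg
    simpa [Groupoid.inv] using this
  · rintro ⟨t, ht, hF⟩
    exact ⟨t, ht.inv, hF⟩

theorem inv_inv (g : E.Groupoid) : g.inv.inv = g := by
  ext1
  · rfl
  · simp [Groupoid.inv]
  · rfl

theorem setInv_setInv (U : Set E.Groupoid) : setInv (setInv U) = U := by
  ext g
  change g.inv.inv ∈ U ↔ _
  rw [inv_inv]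

theorem inv_comp (a b : E.Groupoid) (h : a.src = b.rng) :
    (a.comp b h).inv = b.inv.comp a.inv h.symm := by
  ext1
  · rfl
  · simp [Groupoid.inv, Groupoid.comp]
  · rfl

theorem setInv_setMul (U W : Set E.Groupoid) :
    setInv (setMul U W) = setMul (setInv W) (setInv U) := by
  ext g
  constructor
  · rintro ⟨a, ha, b, hb, h, hg⟩
    refine ⟨b.inv, ?_, a.inv, ?_, h.symm, ?_⟩
    · change b.inv.inv ∈ W; rwa [inv_inv]
    · change a.inv.inv ∈ U; rwa [inv_inv]
    · rw [← inv_comp a b h, hg, inv_inv]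
  · rintro ⟨a, ha, b, hb, h, rfl⟩
    exact ⟨b.inv, hb, a.inv, ha, h.symm, (inv_comp a b h).symm⟩

theorem mul_longer {α β δ : E.FinPath} {m : List Ed} {ha : E.IsWalk α.range m}
    {hb : E.IsWalk β.range m} (h : α.range = β.range) (h' : (β.append m hb).range = δ.range)
    (F F' : Finset Ed) (hm : ∀ e ∈ F, m.head? ≠ some e) :
    setMul (ZF α β F) (ZF (β.append m hb) δ F') =
      setMul (ZF (α.append m ha) (β.append m hb) (restFilter F m)) (ZF (β.append m hb) δ F') := by
  ext g
  constructor
  · rintro ⟨a, hA, b, hB, hab, rfl⟩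
    refine ⟨a, (mem_refine h hm).2 ⟨hA, ?_⟩, b, hB, hab, rfl⟩
    obtain ⟨t, ht, hF⟩ := (mem_ZF h).1 hA
    obtain ⟨t', ht', hF'⟩ := (mem_ZF h').1 hB
    refine ⟨t', ?_⟩
    have : t = prepend m t' := by
      apply prepend_inj β.edges
      rw [← ht.se, hab, ht'.re, ← prepend_append]
      rfl
    rwa [← this]
  · rintro ⟨a, hA, b, hB, hab, rfl⟩
    exact ⟨a, ((mem_refine h hm).1 hA).1, b, hB, hab, rfl⟩

theorem setInv_mem_basicSets {U : Set E.Groupoid} (hU : U ∈ basicSets E) :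
    setInv U ∈ basicSets E := by
  obtain ⟨α, β, F, h, hF, rfl⟩ := hU
  exact ⟨β, α, F, h.symm, by rwa [← h], setInv_ZF h F⟩

open Classical in
theorem setMul_basicSets_aux {α β γ δ : E.FinPath} (h : α.range = β.range)
    (h' : γ.range = δ.range) {F F' : Finset Ed} (hF : (↑F : Set Ed) ⊆ E.out α.range)
    (hF' : (↑F' : Set Ed) ⊆ E.out γ.range) {m : List Ed} (hs : γ.start = β.start)
    (he : γ.edges = β.edges ++ m) (hne : (setMul (ZF α β F) (ZF γ δ F')).Nonempty) :
    setMul (ZF α β F) (ZF γ δ F') ∈ basicSets E := by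
  obtain ⟨hb, rfl⟩ := FinPath.eq_append hs he
  have ha : E.IsWalk α.range m := by rw [h]; exact hb
  have hm : ∀ e ∈ F, m.head? ≠ some e := by
    intro e heF hme
    obtain ⟨_, a, hA, b, hB, hab, rfl⟩ := hne
    obtain ⟨t, ht, hFt⟩ := (mem_ZF h).1 hA
    obtain ⟨t', ht', hF'⟩ := (mem_ZF h').1 hB
    cases m with
    | nil => simp at hme
    | cons e' m =>
      obtain rfl : e' = e := by simpa using hme
      refine hFt e' heF (prepend m t') ?_
      apply prepend_inj β.edges
      rw [← ht.se, hab, ht'.re, ← prepend_cons, ← prepend_append]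
      rfl
  rw [mul_longer (ha := ha) h h' F F' hm, mul_aligned (range_append_congr h) h']
  refine ⟨_, _, _, (range_append_congr h).trans h', ?_, rfl⟩
  rw [Finset.coe_union]
  apply Set.union_subset
  · cases m with
    | nil => simpa [restFilter, FinPath.range_append, walkEnd] using hF
    | cons e m => simp [restFilter]
  · rw [range_append_congr h (hb := hb)]
    exact hF'

theorem setMul_basicSets {U W : Set E.Groupoid} (hU : U ∈ basicSets E) (hW : W ∈ basicSets E)
    (hne : (setMul U W).Nonempty) : setMul U W ∈ basicSets E := by
  obtain ⟨α, β, F, h, hF, rfl⟩ := hU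
  obtain ⟨γ, δ, F', h', hF', rfl⟩ := hW
  have hne' := hne
  obtain ⟨_, a, hA, b, hB, hab, rfl⟩ := hne'
  obtain ⟨t, ht, hFt⟩ := (mem_ZF h).1 hA
  obtain ⟨t', ht', hFt'⟩ := (mem_ZF h').1 hB
  have hs : γ.start = β.start := by rw [← ht'.rs, ← hab, ht.ss]
  have hp : prepend β.edges t = prepend γ.edges t' := by rw [← ht.se, hab, ht'.re]
  rcases prepend_eq_prepend hp with ⟨m, hm, -⟩ | ⟨m, hm, -⟩
  · exact setMul_basicSets_aux h h' hF hF' hs hm hne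
  · have key : setMul (ZF δ γ F') (ZF β α F) ∈ basicSets E := by
      refine setMul_basicSets_aux h'.symm h.symm (by rwa [← h']) (by rwa [← h]) hs.symm hm ?_
      obtain ⟨g, hg⟩ := hne
      refine ⟨g.inv, ?_⟩
      rw [← setInv_ZF h, ← setInv_ZF h', ← setInv_setMul]
      change g.inv.inv ∈ setMul (ZF α β F) (ZF γ δ F')
      rwa [inv_inv]
    have := setInv_mem_basicSets key
    rwa [setInv_setMul, setInv_ZF h.symm, setInv_ZF h'.symm] at this

open Classical in
theorem inter_basicSets_aux {α β γ δ : E.FinPath} (h : α.range = β.range)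
    (h' : γ.range = δ.range) {F F' : Finset Ed} (hF : (↑F : Set Ed) ⊆ E.out α.range)
    (hF' : (↑F' : Set Ed) ⊆ E.out γ.range) {g : E.Groupoid} {m : List Ed} {t : EdgeSeq Ed}
    (ht : IsTail α β g (prepend m t)) (ht' : IsTail γ δ g t) (he : γ.edges = α.edges ++ m)
    (hg : g ∈ ZF α β F) (hg' : g ∈ ZF γ δ F') :
    ∃ U ∈ basicSets E, g ∈ U ∧ U ⊆ ZF α β F ∩ ZF γ δ F' := by
  obtain ⟨ha, rfl⟩ := FinPath.eq_append (by rw [← ht.rs, ht'.rs]) he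
  have hlen : δ.edges.length = (β.edges ++ m).length := by
    have := ht.dg.symm.trans ht'.dg
    simp only [FinPath.length, FinPath.append, List.length_append] at this ⊢
    push_cast at this
    omega
  have hδ : δ.edges = β.edges ++ m :=
    (prepend_inj_of_length hlen (by rw [← ht'.se, ht.se, prepend_append])).1
  obtain ⟨hb, rfl⟩ := FinPath.eq_append (by rw [← ht.ss, ht'.ss]) hδ
  have hm : ∀ e ∈ F, m.head? ≠ some e := by
    intro e heF hme
    obtain ⟨t1, ht1, hFt⟩ := (mem_ZF h).1 hg
    cases m with
    | nil => simp at hme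
    | cons e' m =>
      obtain rfl : e' = e := by simpa using hme
      exact hFt e' heF (prepend m t) (ht1.unique ht)
  have hr := (mem_refine (ha := ha) (hb := hb) h hm).2 ⟨hg, t, ht⟩
  refine ⟨ZF (α.append m ha) (β.append m hb) (restFilter F m ∪ F'), ⟨_, _, _, h', ?_, rfl⟩, ?_, ?_⟩
  · rw [Finset.coe_union]
    apply Set.union_subset
    · cases m with
      | nil => simpa [restFilter, FinPath.range_append, walkEnd] using hF
      | cons e m => simp [restFilter]
    · exact hF'
  · obtain ⟨t1, ht1, hF1⟩ := (mem_ZF h').1 hr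
    obtain ⟨t2, ht2, hF2⟩ := (mem_ZF h').1 hg'
    obtain rfl := ht1.unique ht2
    refine (mem_ZF h').2 ⟨t1, ht1, fun e he => ?_⟩
    rcases Finset.mem_union.1 he with he | he
    · exact hF1 e he
    · exact hF2 e he
  · intro k hk
    obtain ⟨t1, ht1, hF1⟩ := (mem_ZF h').1 hk
    constructor
    · exact ((mem_refine (ha := ha) (hb := hb) h hm).1 ((mem_ZF h').2
        ⟨t1, ht1, fun e he => hF1 e (Finset.mem_union_left _ he)⟩)).1
    · exact (mem_ZF h').2 ⟨t1, ht1, fun e he => hF1 e (Finset.mem_union_right _ he)⟩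

theorem isTopologicalBasis_basicSets : TopologicalSpace.IsTopologicalBasis (basicSets E) := by
  refine ⟨?_, ?_, rfl⟩
  · intro U hU W hW g hg
    obtain ⟨α, β, F, h, hF, rfl⟩ := hU
    obtain ⟨γ, δ, F', h', hF', rfl⟩ := hW
    obtain ⟨t, ht, hFt⟩ := (mem_ZF h).1 hg.1
    obtain ⟨t', ht', hFt'⟩ := (mem_ZF h').1 hg.2
    have hp : prepend α.edges t = prepend γ.edges t' := by rw [← ht.re, ht'.re]
    rcases prepend_eq_prepend hp with ⟨m, hm, rfl⟩ | ⟨m, hm, rfl⟩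
    · exact inter_basicSets_aux h h' hF hF' ht ht' hm hg.1 hg.2
    · rw [Set.inter_comm]
      exact inter_basicSets_aux h' h hF' hF ht' ht hm hg.2 hg.1
  · refine Set.eq_univ_of_forall fun g => ?_
    obtain ⟨α, β, x, hα, hβ, h1, h2, h3⟩ := g.spec
    refine ⟨ZF α β ∅, ⟨α, β, ∅, hα.trans hβ.symm, by simp, rfl⟩, ?_⟩
    rw [ZF_empty]
    exact ⟨x, hα, hβ, h1, h2, h3⟩

theorem isOpen_setMul {U W : Set E.Groupoid} (hU : IsOpen U) (hW : IsOpen W) :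
    IsOpen (setMul U W) := by
  rw [isTopologicalBasis_basicSets.isOpen_iff] at hU hW ⊢
  rintro _ ⟨a, ha, b, hb, hab, rfl⟩
  obtain ⟨A, hA, haA, hAU⟩ := hU a ha
  obtain ⟨B, hB, hbB, hBW⟩ := hW b hb
  refine ⟨setMul A B, setMul_basicSets hA hB ⟨_, a, haA, b, hbB, hab, rfl⟩,
    ⟨a, haA, b, hbB, hab, rfl⟩, ?_⟩
  rintro _ ⟨a', ha', b', hb', h, rfl⟩
  exact ⟨a', hAU ha', b', hBW hb', h, rfl⟩

theorem isOpen_setInv {U : Set E.Groupoid} (hU : IsOpen U) : IsOpen (setInv U) := by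
  rw [isTopologicalBasis_basicSets.isOpen_iff] at hU ⊢
  intro g hg
  obtain ⟨A, hA, haA, hAU⟩ := hU _ hg
  exact ⟨setInv A, setInv_mem_basicSets hA, haA, fun k hk => hAU hk⟩

theorem units_eq : (units E) = ⋃ v : V, Z (FinPath.vertex E v) (FinPath.vertex E v) := by
  ext g
  simp only [Set.mem_iUnion]
  constructor
  · rintro ⟨x, rfl⟩
    exact ⟨x.start, (mem_Z rfl).2 ⟨x.seq, rfl, rfl, rfl, rfl, by simp [Groupoid.unit]⟩⟩
  · rintro ⟨v, hg⟩
    obtain ⟨t, ht⟩ := (mem_Z rfl).1 hg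
    refine ⟨g.rng, ?_⟩
    ext1
    · rfl
    · rw [ht.dg]; simp [Groupoid.unit]
    · ext1
      · exact ht.rs.trans ht.ss.symm
      · exact ht.re.trans ht.se.symm

theorem isOpen_Z {α β : E.FinPath} (h : α.range = β.range) : IsOpen (Z α β) :=
  isTopologicalBasis_basicSets.isOpen ⟨α, β, ∅, h, by simp, (ZF_empty α β).symm⟩

theorem isOpen_units : IsOpen (units E) := by
  rw [units_eq]
  exact isOpen_iUnion fun v => isOpen_Z rfl

theorem continuous_sourceMap : Continuous (sourceMap : E.Groupoid → units E) := by
  refine continuous_def.2 fun W hW => ?_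
  have : sourceMap ⁻¹' W = setMul Set.univ (Subtype.val '' W : Set E.Groupoid) := by
    ext g
    constructor
    · intro hg
      refine ⟨g, trivial, unit g.src, ⟨_, hg, rfl⟩, rfl, ?_⟩
      ext1
      · rfl
      · simp [Groupoid.comp, Groupoid.unit]
      · rfl
    · rintro ⟨a, -, _, ⟨⟨_, x, rfl⟩, hb, rfl⟩, hab, rfl⟩
      exact hb
  rw [this]
  exact isOpen_setMul isOpen_univ (isOpen_units.isOpenMap_subtype_val W hW)

theorem injOn_src_ZF {α β : E.FinPath} (h : α.range = β.range) (F : Finset Ed) {g g' : E.Groupoid}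
    (hg : g ∈ ZF α β F) (hg' : g' ∈ ZF α β F) (he : g.src = g'.src) : g = g' := by
  obtain ⟨t, ht, -⟩ := (mem_ZF h).1 hg
  obtain ⟨t', ht', -⟩ := (mem_ZF h).1 hg'
  obtain rfl : t = t' := prepend_inj β.edges (by rw [← ht.se, he, ht'.se])
  exact ht.eq ht'

theorem isOpenMap_sourceMap : IsOpenMap (sourceMap : E.Groupoid → units E) := by
  rw [isTopologicalBasis_basicSets.isOpenMap_iff]
  intro U hU
  have : sourceMap '' U = Subtype.val ⁻¹' (setMul (setInv U) U) := by
    ext ⟨_, x, rfl⟩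
    constructor
    · rintro ⟨g, hg, hx⟩
      obtain rfl : g.src = x := unit_injective (congrArg Subtype.val hx)
      refine ⟨g.inv, ?_, g, hg, rfl, ?_⟩
      · change g.inv.inv ∈ U; rwa [inv_inv]
      · ext1
        · rfl
        · simp [Groupoid.comp, Groupoid.inv, Groupoid.unit]
        · rfl
    · rintro ⟨a, ha, b, hb, hab, h⟩
      exact ⟨b, hb, Subtype.ext (congrArg (fun k => unit (Groupoid.src k)) h)⟩
  rw [this]
  have hU' := isTopologicalBasis_basicSets.isOpen hU
  exact (isOpen_setMul (isOpen_setInv hU') hU').preimage continuous_subtype_val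

theorem continuous_inv : Continuous (Groupoid.inv : E.Groupoid → E.Groupoid) :=
  continuous_def.2 fun _ hU => isOpen_setInv hU

theorem continuous_rangeMap : Continuous (rangeMap : E.Groupoid → units E) :=
  continuous_sourceMap.comp continuous_inv

theorem image_inv (U : Set E.Groupoid) : Groupoid.inv '' U = setInv U := by
  ext g
  constructor
  · rintro ⟨a, ha, rfl⟩
    change a.inv.inv ∈ U
    rwa [inv_inv]
  · intro hg
    exact ⟨g.inv, hg, inv_inv g⟩

theorem isOpenMap_rangeMap : IsOpenMap (rangeMap : E.Groupoid → units E) := by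
  have h1 : IsOpenMap (Groupoid.inv : E.Groupoid → E.Groupoid) := by
    intro U hU
    rw [image_inv]
    exact isOpen_setInv hU
  exact isOpenMap_sourceMap.comp h1

theorem isCompactOpenBisection_iff {U : Set E.Groupoid} :
    IsCompactOpenBisection U ↔ IsCompact U ∧ IsOpen U ∧
      (∀ g ∈ U, ∀ h ∈ U, g.src = h.src → g = h) ∧ (∀ g ∈ U, ∀ h ∈ U, g.rng = h.rng → g = h) := by
  constructor
  · rintro ⟨h1, h2, h3, h4⟩
    refine ⟨h1, h2, fun g hg h hh e => ?_, fun g hg h hh e => ?_⟩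
    · exact congrArg Subtype.val (h3.injective (a₁ := ⟨g, hg⟩) (a₂ := ⟨h, hh⟩)
        (sourceMap_eq_iff.2 e))
    · exact congrArg Subtype.val (h4.injective (a₁ := ⟨g, hg⟩) (a₂ := ⟨h, hh⟩)
        (rangeMap_eq_iff.2 e))
  · rintro ⟨h1, h2, h3, h4⟩
    refine ⟨h1, h2, ?_, ?_⟩
    · refine .of_continuous_injective_isOpenMap (continuous_sourceMap.comp continuous_subtype_val)
        (fun a b e => Subtype.ext (h3 _ a.2 _ b.2 (sourceMap_eq_iff.1 e)))
        (isOpenMap_sourceMap.comp h2.isOpenMap_subtype_val)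
    · refine .of_continuous_injective_isOpenMap (continuous_rangeMap.comp continuous_subtype_val)
        (fun a b e => Subtype.ext (h4 _ a.2 _ b.2 (rangeMap_eq_iff.1 e)))
        (isOpenMap_rangeMap.comp h2.isOpenMap_subtype_val)

/-! ### Helper facts: compactness -/

/-- The arrows of `Z(α, β)` whose tail starts with `m`. -/
def tailSet (α β : E.FinPath) (m : List Ed) : Set E.Groupoid :=
  {g | ∃ t, IsTail α β g (prepend m t)}

theorem isTail_transfer {α β γ δ : E.FinPath} {g : E.Groupoid} {m n : List Ed} {t : EdgeSeq Ed}
    (hg : IsTail α β g (prepend m t)) (hg' : IsTail γ δ g (prepend n t))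
    (he : α.edges ++ m = γ.edges ++ n) {k : E.Groupoid} {u : EdgeSeq Ed}
    (hk : IsTail α β k (prepend m u)) : IsTail γ δ k (prepend n u) := by
  have hl : α.edges.length + m.length = γ.edges.length + n.length := by
    simpa using congrArg List.length he
  have hd := hg.dg.symm.trans hg'.dg
  simp only [FinPath.length] at hd
  have he' : β.edges ++ m = δ.edges ++ n := by
    refine (prepend_inj_of_length (t := t) (t' := t) ?_ ?_).1
    · simp only [List.length_append]
      omega
    · rw [prepend_append, prepend_append, ← hg.se, ← hg'.se]
  refine ⟨?_, ?_, ?_, ?_, ?_⟩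
  · rw [hk.rs, ← hg.rs, hg'.rs]
  · rw [hk.ss, ← hg.ss, hg'.ss]
  · rw [hk.re, ← prepend_append, he, prepend_append]
  · rw [hk.se, ← prepend_append, he', prepend_append]
  · rw [hk.dg, ← hg.dg, hg'.dg]

/-- `A` is covered by finitely many members of the family `U`. -/
def FinCov {ι : Type*} (U : ι → Set E.Groupoid) (A : Set E.Groupoid) : Prop :=
  ∃ s : Finset ι, A ⊆ ⋃ i ∈ s, U i

theorem FinCov.mono {ι : Type*} {U : ι → Set E.Groupoid} {A B : Set E.Groupoid}
    (h : FinCov U B) (hAB : A ⊆ B) : FinCov U A :=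
  h.imp fun _ hs => hAB.trans hs

theorem finCov_single {ι : Type*} (U : ι → Set E.Groupoid) (i : ι) : FinCov U (U i) :=
  ⟨{i}, by simp⟩

open Classical in
theorem FinCov.union {ι : Type*} {U : ι → Set E.Groupoid} {A B : Set E.Groupoid}
    (hA : FinCov U A) (hB : FinCov U B) : FinCov U (A ∪ B) := by
  obtain ⟨s, hs⟩ := hA
  obtain ⟨s', hs'⟩ := hB
  refine ⟨s ∪ s', Set.union_subset (hs.trans ?_) (hs'.trans ?_)⟩
  · exact Set.biUnion_subset_biUnion_left fun i hi => Finset.mem_union_left _ hi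
  · exact Set.biUnion_subset_biUnion_left fun i hi => Finset.mem_union_right _ hi

theorem finCov_biUnion {ι κ : Type*} {U : ι → Set E.Groupoid} {s : Set κ} (hs : s.Finite)
    {A : κ → Set E.Groupoid} (h : ∀ e ∈ s, FinCov U (A e)) : FinCov U (⋃ e ∈ s, A e) := by
  induction s, hs using Set.Finite.induction_on with
  | empty => exact ⟨∅, by simp⟩
  | insert _ _ ih =>
    rw [Set.biUnion_insert]
    exact (h _ (Set.mem_insert _ _)).union (ih fun e he => h e (Set.mem_insert_of_mem _ he))

theorem exists_basic {ι : Type*} {U : ι → Set E.Groupoid} (hU : ∀ i, IsOpen (U i))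
    {g : E.Groupoid} (hg : g ∈ ⋃ i, U i) :
    ∃ i γ δ F s, γ.range = δ.range ∧ ZF γ δ F ⊆ U i ∧ IsTail γ δ g s ∧
      ∀ e ∈ F, ∀ t', s ≠ cons e t' := by
  obtain ⟨i, hi⟩ := Set.mem_iUnion.1 hg
  obtain ⟨_, ⟨γ, δ, F, h, hF, rfl⟩, hgB, hB⟩ :=
    isTopologicalBasis_basicSets.isOpen_iff.1 (hU i) g hi
  obtain ⟨s, hs, hs'⟩ := (mem_ZF h).1 hgB
  exact ⟨i, γ, δ, F, s, h, hB, hs, hs'⟩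

theorem finCov_step {α β : E.FinPath} (h : α.range = β.range) {ι : Type*}
    {U : ι → Set E.Groupoid} (hU : ∀ i, IsOpen (U i)) (hcov : tailSet α β [] ⊆ ⋃ i, U i)
    (m : List Ed) (hm : ∀ e, FinCov U (tailSet α β (m ++ [e]))) : FinCov U (tailSet α β m) := by
  by_cases hw : E.IsWalk α.range m
  swap
  · refine ⟨∅, ?_⟩
    rintro g ⟨t, ht⟩
    exact absurd (isBoundary_prepend.1 ht.isBoundary).1 hw
  have hsnoc : ∀ (g : E.Groupoid) (e : Ed) (t' : EdgeSeq Ed),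
      IsTail α β g (prepend m (cons e t')) → g ∈ tailSet α β (m ++ [e]) := by
    intro g e t' ht
    refine ⟨t', ?_⟩
    rw [prepend_append]
    exact ht
  by_cases hs : E.IsSink (E.walkEnd α.range m) ∨ E.IsInfiniteEmitter (E.walkEnd α.range m)
  · have hb : E.IsBoundary α.range (prepend m (fin [])) :=
      isBoundary_prepend.2 ⟨hw, trivial, hs⟩
    have hg := isTail_arrow h hb
    obtain ⟨i, γ, δ, F, s, h', hB, hs1, hs2⟩ := exists_basic hU (hcov ⟨_, hg⟩)
    have hn : ∃ n, α.edges ++ m = γ.edges ++ n ∧ s = prepend n (fin []) := by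
      have hp : prepend (α.edges ++ m) (fin []) = prepend γ.edges s := by
        rw [prepend_append, ← hg.re, hs1.re]
      rcases prepend_eq_prepend hp with ⟨n, hn, hn'⟩ | ⟨n, hn, hn'⟩
      · cases n with
        | nil => exact ⟨[], by simpa using hn.symm, hn'.symm⟩
        | cons e n => exact absurd hn'.symm (cons_ne_nil _ _)
      · exact ⟨n, hn, hn'⟩
    obtain ⟨n, hn, rfl⟩ := hn
    refine ((finCov_single U i).union (finCov_biUnion F.finite_toSet
      (A := fun e => tailSet α β (m ++ [e])) fun e _ => hm e)).mono ?_
    rintro k ⟨t, hk⟩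
    by_cases ht : ∃ e ∈ F, ∃ t', t = cons e t'
    · obtain ⟨e, he, t', rfl⟩ := ht
      exact Or.inr (Set.mem_biUnion (Finset.mem_coe.2 he) (hsnoc k e t' hk))
    · refine Or.inl (hB ((mem_ZF h').2 ⟨_, isTail_transfer hg hs1 hn hk, ?_⟩))
      intro e he t' htt
      cases n with
      | nil => exact ht ⟨e, he, t', htt⟩
      | cons e' n =>
        obtain ⟨rfl, -⟩ := cons_inj htt
        exact hs2 _ he _ rfl
  · rw [not_or] at hs
    have hfin : (E.out (E.walkEnd α.range m)).Finite := Set.not_infinite.1 hs.2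
    refine (finCov_biUnion hfin (A := fun e => tailSet α β (m ++ [e])) fun e _ => hm e).mono ?_
    rintro k ⟨t, hk⟩
    have hb := (isBoundary_prepend.1 hk.isBoundary).2
    rcases eq_nil_or_cons t with rfl | ⟨e, t', rfl⟩
    · exact absurd hb.2 (not_or.2 hs)
    · exact Set.mem_biUnion (isBoundary_cons.1 hb).1 (hsnoc k e t' hk)

theorem finCov_tailSet {α β : E.FinPath} (h : α.range = β.range) {ι : Type*}
    {U : ι → Set E.Groupoid} (hU : ∀ i, IsOpen (U i)) (hcov : tailSet α β [] ⊆ ⋃ i, U i) :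
    FinCov U (tailSet α β []) := by
  by_contra hbad
  have hstep : ∀ m, ¬ FinCov U (tailSet α β m) → ∃ e, ¬ FinCov U (tailSet α β (m ++ [e])) := by
    intro m hm
    by_contra hc
    exact hm (finCov_step h hU hcov m fun e => by
      by_contra he
      exact hc ⟨e, he⟩)
  obtain ⟨e0, -⟩ := hstep [] hbad
  have hstep' : ∀ m, ∃ e, ¬ FinCov U (tailSet α β m) → ¬ FinCov U (tailSet α β (m ++ [e])) := by
    intro m
    by_cases hm : FinCov U (tailSet α β m)
    · exact ⟨e0, fun h => absurd hm h⟩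
    · obtain ⟨e, he⟩ := hstep m hm
      exact ⟨e, fun _ => he⟩
  choose nxt hnxt using hstep'
  obtain ⟨L, f, hL0, hL, hf⟩ : ∃ (L : ℕ → List Ed) (f : ℕ → Ed), L 0 = [] ∧
      (∀ n, L (n + 1) = L n ++ [f n]) ∧ ∀ n, f n = nxt (L n) :=
    ⟨fun n => Nat.rec [] (fun _ l => l ++ [nxt l]) n,
      fun n => nxt (Nat.rec [] (fun _ l => l ++ [nxt l]) n), rfl, fun _ => rfl, fun _ => rfl⟩
  have hbadL : ∀ n, ¬ FinCov U (tailSet α β (L n)) := by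
    intro n
    induction n with
    | zero => rwa [hL0]
    | succ n ih =>
      rw [hL, hf]
      exact hnxt _ ih
  have hlen : ∀ n, (L n).length = n := by
    intro n
    induction n with
    | zero => rw [hL0]; rfl
    | succ n ih => rw [hL, List.length_append, ih]; rfl
  have hwalk : ∀ n, E.IsWalk α.range (L n) := by
    intro n
    by_contra hw
    refine hbadL n ⟨∅, ?_⟩
    rintro g ⟨t, ht⟩
    exact absurd (isBoundary_prepend.1 ht.isBoundary).1 hw
  have htl : ∀ n, prepend (L n) (inf fun i => f (n + i)) = inf f := by
    intro n
    induction n with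
    | zero => simp [hL0]
    | succ n ih =>
      rw [hL, prepend_append, ← ih]
      congr 1
      simp only [prepend_cons, prepend_nil, cons, inf.injEq]
      funext i
      cases i with
      | zero => rfl
      | succ i => exact congrArg f (by omega : n + 1 + i = n + (i + 1))
  have hb : E.IsBoundary α.range (inf f) := by
    refine ⟨?_, fun i => ?_⟩
    · have := hwalk (0 + 1)
      rw [hL, hL0] at this
      exact this.1
    · have := hwalk (i + 1 + 1)
      rw [hL, isWalk_append, hL, walkEnd_append] at this
      exact this.2.1.symm
  have hg := isTail_arrow h hb
  obtain ⟨i, γ, δ, F, s, h', hB, hs1, hs2⟩ := exists_basic hU (hcov ⟨_, hg⟩)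
  obtain ⟨n, hn⟩ : ∃ n, n = γ.edges.length + 1 := ⟨_, rfl⟩
  replace hg : IsTail α β (arrow α β h (inf f) hb) (prepend (L n) (inf fun i => f (n + i))) := by
    rw [htl n]
    exact hg
  have hp : prepend (α.edges ++ L n) (inf fun i => f (n + i)) = prepend γ.edges s := by
    rw [prepend_append, ← hg.re, hs1.re]
  rcases prepend_eq_prepend hp with ⟨m, hm, -⟩ | ⟨m, hm, rfl⟩
  · have := congrArg List.length hm
    simp only [List.length_append, hlen] at this
    omega
  · refine hbadL n ((finCov_single U i).mono ?_)
    rintro k ⟨t, hk⟩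
    refine hB ((mem_ZF h').2 ⟨_, isTail_transfer hg hs1 hm hk, ?_⟩)
    cases m with
    | nil =>
      have := congrArg List.length hm
      simp only [List.length_append, hlen, List.length_nil] at this
      omega
    | cons e' m =>
      intro e he t' htt
      obtain ⟨rfl, -⟩ := cons_inj htt
      exact hs2 _ he _ rfl

theorem isCompact_Z {α β : E.FinPath} (h : α.range = β.range) : IsCompact (Z α β) := by
  have : Z α β = tailSet α β [] := by
    ext g
    exact mem_Z h
  rw [this]
  exact isCompact_of_finite_subcover fun U hU hcov => finCov_tailSet h hU hcov

theorem isCompact_basicSets {U : Set E.Groupoid} (hU : U ∈ basicSets E) : IsCompact U := by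
  obtain ⟨α, β, F, h, hF, rfl⟩ := hU
  refine (isCompact_Z h).diff ?_
  have : {g | ∃ e ∈ F, ∃ (hα : E.src e = α.range) (hβ : E.src e = β.range),
      g ∈ Z (α.snoc e hα) (β.snoc e hβ)} =
      ⋃ e, ⋃ (_ : e ∈ F), ⋃ (hα : E.src e = α.range), ⋃ (hβ : E.src e = β.range),
        Z (α.snoc e hα) (β.snoc e hβ) := by
    ext g
    simp
  rw [this]
  refine isOpen_iUnion fun e => isOpen_iUnion fun _ => isOpen_iUnion fun _ =>
    isOpen_iUnion fun _ => isOpen_Z ?_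
  rw [FinPath.range_snoc, FinPath.range_snoc]

theorem isCompactOpenBisection_basicSets {U : Set E.Groupoid} (hU : U ∈ basicSets E) :
    IsCompactOpenBisection U := by
  refine isCompactOpenBisection_iff.2 ⟨isCompact_basicSets hU,
    isTopologicalBasis_basicSets.isOpen hU, ?_, ?_⟩
  · obtain ⟨α, β, F, h, hF, rfl⟩ := hU
    exact fun g hg k hk e => injOn_src_ZF h F hg hk e
  · obtain ⟨α, β, F, h, hF, rfl⟩ := hU
    intro g hg k hk e
    rw [← setInv_ZF h.symm] at hg hk
    rw [← inv_inv g, ← inv_inv k, injOn_src_ZF h.symm F hg hk e]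

theorem isCompactOpenBisection_Z {α β : E.FinPath} (h : α.range = β.range) :
    IsCompactOpenBisection (Z α β) :=
  isCompactOpenBisection_basicSets ⟨α, β, ∅, h, by simp, (ZF_empty α β).symm⟩

theorem isCompact_setMul {U W : Set E.Groupoid} (hU : IsCompact U) (hU' : IsOpen U)
    (hW : IsCompact W) (hW' : IsOpen W) : IsCompact (setMul U W) := by
  obtain ⟨s, rfl⟩ := eq_sUnion_finset_of_isTopologicalBasis_of_isCompact_open _
    isTopologicalBasis_basicSets U hU hU'
  obtain ⟨s', rfl⟩ := eq_sUnion_finset_of_isTopologicalBasis_of_isCompact_open _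
    isTopologicalBasis_basicSets W hW hW'
  have : setMul (⋃₀ (Subtype.val '' (s : Set (basicSets E))))
      (⋃₀ (Subtype.val '' (s' : Set (basicSets E)))) =
      ⋃ A ∈ (s : Set (basicSets E)), ⋃ B ∈ (s' : Set (basicSets E)),
        setMul (A : Set E.Groupoid) (B : Set E.Groupoid) := by
    ext g
    simp only [Set.mem_iUnion]
    constructor
    · rintro ⟨a, ⟨_, ⟨A, hA, rfl⟩, ha⟩, b, ⟨_, ⟨B, hB, rfl⟩, hb⟩, h, rfl⟩
      exact ⟨A, hA, B, hB, a, ha, b, hb, h, rfl⟩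
    · rintro ⟨A, hA, B, hB, a, ha, b, hb, h, rfl⟩
      exact ⟨a, ⟨_, ⟨A, hA, rfl⟩, ha⟩, b, ⟨_, ⟨B, hB, rfl⟩, hb⟩, h, rfl⟩
  rw [this]
  refine s.finite_toSet.isCompact_biUnion fun A _ => s'.finite_toSet.isCompact_biUnion fun B _ => ?_
  rcases Set.eq_empty_or_nonempty (setMul (A : Set E.Groupoid) (B : Set E.Groupoid)) with h | h
  · rw [h]
    exact isCompact_empty
  · exact isCompact_basicSets (setMul_basicSets A.2 B.2 h)

theorem IsCompactOpenBisection.setMul {U W : Set E.Groupoid} (hU : IsCompactOpenBisection U)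
    (hW : IsCompactOpenBisection W) : IsCompactOpenBisection (setMul U W) := by
  rw [isCompactOpenBisection_iff] at *
  obtain ⟨u1, u2, u3, u4⟩ := hU
  obtain ⟨w1, w2, w3, w4⟩ := hW
  refine ⟨isCompact_setMul u1 u2 w1 w2, isOpen_setMul u2 w2, ?_, ?_⟩
  · rintro _ ⟨a, ha, b, hb, h, rfl⟩ _ ⟨a', ha', b', hb', h', rfl⟩ e
    obtain rfl := w3 b hb b' hb' e
    obtain rfl := u3 a ha a' ha' (h.trans h'.symm)
    rfl
  · rintro _ ⟨a, ha, b, hb, h, rfl⟩ _ ⟨a', ha', b', hb', h', rfl⟩ e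
    obtain rfl := u4 a ha a' ha' e
    obtain rfl := w4 b hb b' hb' (h.symm.trans h')
    rfl

theorem comp_assoc (a b c : E.Groupoid) (h : a.src = b.rng) (h' : b.src = c.rng) :
    (a.comp b h).comp c h' = a.comp (b.comp c h') h := by
  ext1
  · rfl
  · simp [Groupoid.comp, add_assoc]
  · rfl

theorem setMul_assoc (U W X : Set E.Groupoid) :
    setMul (setMul U W) X = setMul U (setMul W X) := by
  ext g
  constructor
  · rintro ⟨_, ⟨a, ha, b, hb, h, rfl⟩, c, hc, h', rfl⟩
    exact ⟨a, ha, b.comp c h', ⟨b, hb, c, hc, h', rfl⟩, h, (comp_assoc a b c h h').symm⟩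
  · rintro ⟨a, ha, _, ⟨b, hb, c, hc, h', rfl⟩, h, rfl⟩
    exact ⟨a.comp b h, ⟨a, ha, b, hb, h, rfl⟩, c, hc, h', comp_assoc a b c h h'⟩

/-! ### The Steinberg algebra of the graph groupoid -/

section Steinberg

variable {S : Type w} [CommSemiring S]

/-- The convolution `(f * g)(γ) = ∑ f(α) g(β)` over all composable pairs with `α β = γ`. -/
noncomputable def conv (f g : E.Groupoid → S) : E.Groupoid → S := fun γ =>
  ∑ᶠ p : {p : E.Groupoid × E.Groupoid // ∃ h : p.1.src = p.2.rng, p.1.comp p.2 h = γ},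
    f p.1.1 * g p.1.2

variable (S) in
/-- The characteristic function `1_U`. -/
noncomputable def ind (U : Set E.Groupoid) : E.Groupoid → S := U.indicator fun _ => 1

variable (E S) in
/-- `A_S(𝒢_E)` as a semimodule: the span of the functions `1_U`, for `U` a compact open
bisection. -/
def steinbergSubmodule : Submodule S (E.Groupoid → S) :=
  Submodule.span S {f | ∃ U : Set E.Groupoid, IsCompactOpenBisection U ∧ f = ind S U}

theorem ind_mem {U : Set E.Groupoid} (hU : IsCompactOpenBisection U) :
    ind S U ∈ steinbergSubmodule E S :=
  Submodule.subset_span ⟨U, hU, rfl⟩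

theorem steinberg_finite {f : E.Groupoid → S} (hf : f ∈ steinbergSubmodule E S)
    (x : E.BoundaryPath) : {a : E.Groupoid | a.rng = x ∧ f a ≠ 0}.Finite := by
  induction hf using Submodule.span_induction with
  | mem f hf =>
    obtain ⟨U, hU, rfl⟩ := hf
    have h4 := (isCompactOpenBisection_iff.1 hU).2.2.2
    refine Set.Subsingleton.finite ?_
    rintro a ⟨ha, ha'⟩ b ⟨hb, hb'⟩
    exact h4 a (Set.mem_of_indicator_ne_zero ha') b (Set.mem_of_indicator_ne_zero hb')
      (ha.trans hb.symm)
  | zero => simp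
  | add f g _ _ hf hg =>
    refine (hf.union hg).subset ?_
    rintro a ⟨ha, ha'⟩
    by_cases h : f a = 0
    · exact Or.inr ⟨ha, fun h' => ha' (by simp [h, h'])⟩
    · exact Or.inl ⟨ha, h⟩
  | smul s f _ hf =>
    refine hf.subset ?_
    rintro a ⟨ha, ha'⟩
    exact ⟨ha, fun h => ha' (by simp [h])⟩

theorem comp_left_cancel {a b b' : E.Groupoid} (h : a.src = b.rng) (h' : a.src = b'.rng)
    (heq : a.comp b h = a.comp b' h') : b = b' := by
  ext1
  · exact h.symm.trans h'
  · have := congrArg Groupoid.deg heq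
    simpa [Groupoid.comp] using this
  · have := congrArg Groupoid.src heq
    exact this

theorem conv_finite {f : E.Groupoid → S} (hf : f ∈ steinbergSubmodule E S) (g : E.Groupoid → S)
    (γ : E.Groupoid) :
    (Function.support fun p : {p : E.Groupoid × E.Groupoid //
      ∃ h : p.1.src = p.2.rng, p.1.comp p.2 h = γ} => f p.1.1 * g p.1.2).Finite := by
  refine Set.Finite.of_finite_image (f := fun p => p.1.1)
    ((steinberg_finite hf γ.rng).subset ?_) ?_
  · rintro _ ⟨⟨⟨a, b⟩, h, rfl⟩, hp, rfl⟩
    exact ⟨rfl, left_ne_zero_of_mul hp⟩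
  · rintro ⟨⟨a, b⟩, h, e⟩ - ⟨⟨a', b'⟩, h', e'⟩ - haa
    obtain rfl : a = a' := haa
    obtain rfl : b = b' := comp_left_cancel h h' (e.trans e'.symm)
    rfl

theorem add_conv {f f' : E.Groupoid → S} (hf : f ∈ steinbergSubmodule E S)
    (hf' : f' ∈ steinbergSubmodule E S) (g : E.Groupoid → S) :
    conv (f + f') g = conv f g + conv f' g := by
  funext γ
  simp only [conv, Pi.add_apply, add_mul]
  exact finsum_add_distrib (conv_finite hf g γ) (conv_finite hf' g γ)

theorem conv_add {f : E.Groupoid → S} (hf : f ∈ steinbergSubmodule E S)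
    (g g' : E.Groupoid → S) : conv f (g + g') = conv f g + conv f g' := by
  funext γ
  simp only [conv, Pi.add_apply, mul_add]
  exact finsum_add_distrib (conv_finite hf g γ) (conv_finite hf g' γ)

theorem zero_conv (g : E.Groupoid → S) : conv 0 g = 0 := by
  funext γ
  simp [conv]

theorem conv_zero (g : E.Groupoid → S) : conv g 0 = 0 := by
  funext γ
  simp [conv]

theorem conv_smul {f : E.Groupoid → S} (hf : f ∈ steinbergSubmodule E S) (s : S)
    (g : E.Groupoid → S) : conv f (s • g) = s • conv f g := by
  funext γ
  simp only [conv, Pi.smul_apply, smul_eq_mul]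
  rw [mul_finsum' _ _ (conv_finite hf g γ)]
  exact finsum_congr fun p => by ring

theorem smul_conv {f : E.Groupoid → S} (hf : f ∈ steinbergSubmodule E S) (s : S)
    (g : E.Groupoid → S) : conv (s • f) g = s • conv f g := by
  funext γ
  simp only [conv, Pi.smul_apply, smul_eq_mul]
  rw [mul_finsum' _ _ (conv_finite hf g γ)]
  exact finsum_congr fun p => by ring

/-- `1_U * 1_W = 1_{U W}`. -/
theorem ind_conv {U W : Set E.Groupoid} (hU : IsCompactOpenBisection U) :
    conv (ind S U) (ind S W) = ind S (setMul U W) := by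
  have hU4 := (isCompactOpenBisection_iff.1 hU).2.2.2
  funext γ
  by_cases hγ : γ ∈ setMul U W
  · obtain ⟨a, ha, b, hb, h, rfl⟩ := hγ
    have h1 : ind S (setMul U W) (a.comp b h) = 1 :=
      Set.indicator_of_mem (show a.comp b h ∈ setMul U W from ⟨a, ha, b, hb, h, rfl⟩) _
    rw [h1, conv, finsum_eq_single _ ⟨(a, b), h, rfl⟩]
    · simp [ind, ha, hb]
    · rintro ⟨⟨a', b'⟩, h', e⟩ hne
      by_cases ha' : a' ∈ U
      · obtain rfl : a' = a := hU4 a' ha' a ha (by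
          have hr := congrArg Groupoid.rng e
          exact hr)
        obtain rfl : b' = b := comp_left_cancel h' h e
        exact absurd rfl hne
      · simp [ind, ha']
  · have h1 : ind S (setMul U W) γ = 0 := Set.indicator_of_notMem hγ _
    rw [h1, conv]
    refine finsum_eq_zero_of_forall_eq_zero ?_
    rintro ⟨⟨a, b⟩, h, e⟩
    by_cases ha : a ∈ U
    · by_cases hb : b ∈ W
      · exact absurd ⟨a, ha, b, hb, h, e⟩ hγ
      · simp [ind, hb]
    · simp [ind, ha]

theorem conv_mem {f g : E.Groupoid → S} (hf : f ∈ steinbergSubmodule E S)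
    (hg : g ∈ steinbergSubmodule E S) : conv f g ∈ steinbergSubmodule E S := by
  induction hf, hg using Submodule.span_induction₂ with
  | mem_mem x y hx hy =>
    obtain ⟨U, hU, rfl⟩ := hx
    obtain ⟨W, hW, rfl⟩ := hy
    rw [ind_conv hU]
    exact ind_mem (hU.setMul hW)
  | zero_left y hy => rw [zero_conv]; exact zero_mem _
  | zero_right x hx => rw [conv_zero]; exact zero_mem _
  | add_left x y z hx hy hz h1 h2 => rw [add_conv hx hy]; exact add_mem h1 h2
  | add_right x y z hx hy hz h1 h2 => rw [conv_add hx]; exact add_mem h1 h2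
  | smul_left r x y hx hy h => rw [smul_conv hx]; exact Submodule.smul_mem _ r h
  | smul_right r x y hx hy h => rw [conv_smul hx]; exact Submodule.smul_mem _ r h

theorem conv_assoc {f g k : E.Groupoid → S} (hf : f ∈ steinbergSubmodule E S)
    (hg : g ∈ steinbergSubmodule E S) (hk : k ∈ steinbergSubmodule E S) :
    conv (conv f g) k = conv f (conv g k) := by
  induction hf, hg using Submodule.span_induction₂ with
  | mem_mem x y hx hy =>
    obtain ⟨U, hU, rfl⟩ := hx
    obtain ⟨W, hW, rfl⟩ := hy
    induction hk using Submodule.span_induction with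
    | mem z hz =>
      obtain ⟨X, hX, rfl⟩ := hz
      rw [ind_conv hU, ind_conv hW, ind_conv hU, ind_conv (hU.setMul hW), setMul_assoc]
    | zero => rw [conv_zero, conv_zero, conv_zero]
    | add z z' _ _ h h' =>
      rw [conv_add (conv_mem (ind_mem hU) (ind_mem hW)), conv_add (ind_mem hW),
        conv_add (ind_mem hU), h, h']
    | smul s z _ h =>
      rw [conv_smul (conv_mem (ind_mem hU) (ind_mem hW)), conv_smul (ind_mem hW),
        conv_smul (ind_mem hU), h]
  | zero_left y hy => rw [zero_conv, zero_conv, zero_conv]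
  | zero_right x hx => rw [conv_zero, zero_conv, conv_zero]
  | add_left x y z hx hy hz h1 h2 =>
    rw [add_conv hx hy, add_conv (conv_mem hx hz) (conv_mem hy hz), add_conv hx hy, h1, h2]
  | add_right x y z hx hy hz h1 h2 =>
    rw [conv_add hx, add_conv (conv_mem hx hy) (conv_mem hx hz), add_conv hy hz, conv_add hx,
      h1, h2]
  | smul_left r x y hx hy h =>
    rw [smul_conv hx, smul_conv (conv_mem hx hy), smul_conv hx, h]
  | smul_right r x y hx hy h =>
    rw [conv_smul hx, smul_conv (conv_mem hx hy), smul_conv hy, conv_smul hx, h]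

end Steinberg

section Algebras

variable (E) (S : Type w) [CommSemiring S]

/-- The Steinberg algebra `A_S(𝒢_E)`. -/
def SteinbergAlgebra : Type (max u v w) := steinbergSubmodule E S

noncomputable instance : AddCommMonoid (E.SteinbergAlgebra S) :=
  inferInstanceAs (AddCommMonoid (steinbergSubmodule E S))

noncomputable instance : Module S (E.SteinbergAlgebra S) :=
  inferInstanceAs (Module S (steinbergSubmodule E S))

noncomputable instance : Mul (E.SteinbergAlgebra S) :=
  ⟨fun f g => ⟨conv f.1 g.1, conv_mem f.2 g.2⟩⟩

noncomputable instance : NonUnitalSemiring (E.SteinbergAlgebra S) where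
  left_distrib f g h := Subtype.ext (conv_add f.2 g.1 h.1)
  right_distrib f g h := Subtype.ext (add_conv f.2 g.2 h.1)
  zero_mul f := Subtype.ext (zero_conv f.1)
  mul_zero f := Subtype.ext (conv_zero f.1)
  mul_assoc f g h := Subtype.ext (conv_assoc f.2 g.2 h.2)

instance : IsScalarTower S (E.SteinbergAlgebra S) (E.SteinbergAlgebra S) :=
  ⟨fun s f g => Subtype.ext (smul_conv f.2 s g.1)⟩

instance : SMulCommClass S (E.SteinbergAlgebra S) (E.SteinbergAlgebra S) :=
  ⟨fun s f g => Subtype.ext (conv_smul f.2 s g.1).symm⟩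

variable {E} in
/-- `1_U` as an element of the Steinberg algebra. -/
noncomputable def oneOn (U : Set E.Groupoid) (hU : IsCompactOpenBisection U) :
    E.SteinbergAlgebra S := ⟨ind S U, ind_mem hU⟩

/-! ### The Leavitt path algebra -/

/-- The generators `v`, `e` and `e*` of the Leavitt path algebra. -/
inductive Gen (V : Type u) (Ed : Type v) where
  | vertex (v : V) : Gen V Ed
  | edge (e : Ed) : Gen V Ed
  | ghost (e : Ed) : Gen V Ed

/-- The free (associative, not necessarily unital) `S`-algebra on the generators. -/
abbrev FreeAlg (V : Type u) (Ed : Type v) (S : Type w) [CommSemiring S] : Type (max u v w) :=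
  MonoidAlgebra S (FreeSemigroup (Gen V Ed))

variable {S} in
/-- A generator as an element of the free algebra. -/
noncomputable def genOf (x : Gen V Ed) : FreeAlg V Ed S :=
  MonoidAlgebra.single (FreeSemigroup.of x) 1

open Gen in
/-- The defining relations of the Leavitt path algebra. -/
inductive LeavittRel : FreeAlg V Ed S → FreeAlg V Ed S → Prop
  | vertex_self (v : V) : LeavittRel (genOf (vertex v) * genOf (vertex v)) (genOf (vertex v))
  | vertex_ne (v v' : V) (h : v ≠ v') : LeavittRel (genOf (vertex v) * genOf (vertex v')) 0
  | src_edge (e : Ed) :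
      LeavittRel (genOf (vertex (E.src e)) * genOf (edge e)) (genOf (edge e))
  | edge_rng (e : Ed) :
      LeavittRel (genOf (edge e) * genOf (vertex (E.rng e))) (genOf (edge e))
  | rng_ghost (e : Ed) :
      LeavittRel (genOf (vertex (E.rng e)) * genOf (ghost e)) (genOf (ghost e))
  | ghost_src (e : Ed) :
      LeavittRel (genOf (ghost e) * genOf (vertex (E.src e))) (genOf (ghost e))
  | ghost_edge_self (e : Ed) :
      LeavittRel (genOf (ghost e) * genOf (edge e)) (genOf (vertex (E.rng e)))
  | ghost_edge_ne (e f : Ed) (h : e ≠ f) : LeavittRel (genOf (ghost e) * genOf (edge f)) 0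
  | regular (v : V) (h : E.IsRegular v) :
      LeavittRel (genOf (vertex v)) (∑ e ∈ h.2.toFinset, genOf (edge e) * genOf (ghost e))

/-- The `S`-algebra congruence generated by the defining relations. Closing the relations under
scalars first makes the generated ring congruence compatible with the scalar multiplication. -/
noncomputable def leavittCon : RingCon (FreeAlg V Ed S) :=
  ringConGen fun a b => ∃ (s : S) (a' b' : FreeAlg V Ed S),
    LeavittRel E S a' b' ∧ a = s • a' ∧ b = s • b'

variable {S} in
theorem leavittCon_smul (s : S) {a b : FreeAlg V Ed S} (h : leavittCon E S a b) :
    leavittCon E S (s • a) (s • b) := by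
  change RingConGen.Rel _ a b at h
  induction h with
  | of x y h =>
    obtain ⟨r, a', b', h, rfl, rfl⟩ := h
    exact RingConGen.Rel.of _ _ ⟨s * r, a', b', h, by rw [mul_smul], by rw [mul_smul]⟩
  | refl x => exact (leavittCon E S).refl _
  | symm _ ih => exact (leavittCon E S).symm ih
  | trans _ _ ih ih' => exact (leavittCon E S).trans ih ih'
  | add _ _ ih ih' =>
    rw [smul_add, smul_add]
    exact (leavittCon E S).add ih ih'
  | mul _ h' ih _ =>
    rw [← smul_mul_assoc, ← smul_mul_assoc]
    exact (leavittCon E S).mul ih h'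

/-- The Leavitt path algebra `L_S(E)`. -/
def LeavittPathAlgebra : Type (max u v w) := (leavittCon E S).Quotient

noncomputable instance : NonUnitalSemiring (E.LeavittPathAlgebra S) :=
  inferInstanceAs (NonUnitalSemiring (leavittCon E S).Quotient)

variable {S} in
/-- The class of an element of the free algebra. -/
noncomputable def leavittMk (a : FreeAlg V Ed S) : E.LeavittPathAlgebra S := (a : (leavittCon E S).Quotient)

theorem leavittMk_surjective : Function.Surjective (leavittMk E : FreeAlg V Ed S → _) :=
  Quotient.mk''_surjective

theorem leavittMk_eq {a b : FreeAlg V Ed S} : leavittMk E a = leavittMk E b ↔ leavittCon E S a b :=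
  RingCon.eq _

noncomputable instance : SMul S (E.LeavittPathAlgebra S) :=
  ⟨fun s x => RingCon.smulAux (leavittCon E S) (fun s _ _ h => leavittCon_smul E s h) s x⟩

variable {S} in
theorem smul_leavittMk (s : S) (a : FreeAlg V Ed S) :
    s • leavittMk E a = leavittMk E (s • a) := rfl

variable {S} in
theorem leavittMk_add (a b : FreeAlg V Ed S) :
    leavittMk E (a + b) = leavittMk E a + leavittMk E b := rfl

variable {S} in
theorem leavittMk_mul (a b : FreeAlg V Ed S) :
    leavittMk E (a * b) = leavittMk E a * leavittMk E b := rfl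

theorem leavittMk_zero : leavittMk E (0 : FreeAlg V Ed S) = 0 := rfl

noncomputable instance : Module S (E.LeavittPathAlgebra S) where
  one_smul x := by
    obtain ⟨a, rfl⟩ := leavittMk_surjective E S x
    rw [smul_leavittMk, one_smul]
  mul_smul s r x := by
    obtain ⟨a, rfl⟩ := leavittMk_surjective E S x
    simp only [smul_leavittMk, mul_smul]
  smul_zero s := by
    rw [← leavittMk_zero, smul_leavittMk, smul_zero]
  smul_add s x y := by
    obtain ⟨a, rfl⟩ := leavittMk_surjective E S x
    obtain ⟨b, rfl⟩ := leavittMk_surjective E S y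
    simp only [smul_leavittMk, ← leavittMk_add, smul_add]
  add_smul s r x := by
    obtain ⟨a, rfl⟩ := leavittMk_surjective E S x
    simp only [smul_leavittMk, ← leavittMk_add, add_smul]
  zero_smul x := by
    obtain ⟨a, rfl⟩ := leavittMk_surjective E S x
    rw [smul_leavittMk, zero_smul, leavittMk_zero]

instance : IsScalarTower S (E.LeavittPathAlgebra S) (E.LeavittPathAlgebra S) :=
  ⟨fun s x y => by
    obtain ⟨a, rfl⟩ := leavittMk_surjective E S x
    obtain ⟨b, rfl⟩ := leavittMk_surjective E S y
    simp only [smul_eq_mul, smul_leavittMk, ← leavittMk_mul, smul_mul_assoc]⟩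

instance : SMulCommClass S (E.LeavittPathAlgebra S) (E.LeavittPathAlgebra S) :=
  ⟨fun s x y => by
    obtain ⟨a, rfl⟩ := leavittMk_surjective E S x
    obtain ⟨b, rfl⟩ := leavittMk_surjective E S y
    simp only [smul_eq_mul, smul_leavittMk, ← leavittMk_mul, mul_smul_comm]⟩

variable {E S} in
/-- The image of a generator in the Leavitt path algebra. -/
noncomputable def leavittGen (x : Gen V Ed) : E.LeavittPathAlgebra S := leavittMk E (genOf x)

/-! ### The natural homomorphism -/

open FinPath

theorem isBis_vertex (v : V) : IsCompactOpenBisection (Z (vertex E v) (vertex E v)) :=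
  isCompactOpenBisection_Z rfl

theorem isBis_edge (e : Ed) : IsCompactOpenBisection (Z (edge E e) (vertex E (E.rng e))) :=
  isCompactOpenBisection_Z rfl

theorem isBis_ghost (e : Ed) : IsCompactOpenBisection (Z (vertex E (E.rng e)) (edge E e)) :=
  isCompactOpenBisection_Z rfl

/-- The images of the generators: `v ↦ 1_{Z(v, v)}`, `e ↦ 1_{Z(e, r(e))}` and
`e* ↦ 1_{Z(r(e), e)}`. -/
noncomputable def genImage : Gen V Ed → E.SteinbergAlgebra S
  | .vertex v => oneOn S (Z (vertex E v) (vertex E v)) (isBis_vertex E v)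
  | .edge e => oneOn S (Z (edge E e) (vertex E (E.rng e))) (isBis_edge E e)
  | .ghost e => oneOn S (Z (vertex E (E.rng e)) (edge E e)) (isBis_ghost E e)

/-- The homomorphism from the free algebra determined by `genImage`. -/
noncomputable def freeHom : FreeAlg V Ed S →ₙₐ[S] E.SteinbergAlgebra S :=
  MonoidAlgebra.liftMagma S (FreeSemigroup.lift (genImage E S))

theorem freeHom_genOf (x : Gen V Ed) : freeHom E S (genOf x) = genImage E S x := by
  simp [freeHom, genOf]

variable {E} in
theorem Z_mul_Z {α β δ : E.FinPath} (h : α.range = β.range) (h' : β.range = δ.range) :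
    setMul (Z α β) (Z β δ) = Z α δ := by
  have := mul_aligned h h' ∅ ∅
  simpa only [ZF_empty, Finset.union_empty] using this

theorem Z_src_edge (e : Ed) :
    setMul (Z (vertex E (E.src e)) (vertex E (E.src e))) (Z (edge E e) (vertex E (E.rng e))) =
      Z (edge E e) (vertex E (E.rng e)) := by
  have hw : E.IsWalk (vertex E (E.src e)).range [e] := ⟨rfl, trivial⟩
  have := mul_longer (α := vertex E (E.src e)) (β := vertex E (E.src e))
    (δ := vertex E (E.rng e)) (m := [e]) (ha := hw) (hb := hw) rfl rfl ∅ ∅ (by simp)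
  simp only [ZF_empty, restFilter] at this
  exact this.trans (Z_mul_Z rfl rfl)

theorem setInv_Z {α β : E.FinPath} (h : α.range = β.range) : setInv (Z α β) = Z β α := by
  rw [← ZF_empty, setInv_ZF h, ZF_empty]

theorem Z_ghost_src (e : Ed) :
    setMul (Z (vertex E (E.rng e)) (edge E e)) (Z (vertex E (E.src e)) (vertex E (E.src e))) =
      Z (vertex E (E.rng e)) (edge E e) := by
  have := congrArg setInv (Z_src_edge E e)
  rwa [setInv_setMul, setInv_Z E (α := edge E e) (β := vertex E (E.rng e)) rfl,
    setInv_Z E (α := vertex E (E.src e)) rfl] at this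

theorem oneOn_mul {U W X : Set E.Groupoid} (hU : IsCompactOpenBisection U)
    (hW : IsCompactOpenBisection W) (hX : IsCompactOpenBisection X) (h : setMul U W = X) :
    oneOn S U hU * oneOn S W hW = oneOn S X hX := by
  subst h
  exact Subtype.ext (ind_conv hU)

theorem oneOn_mul_zero {U W : Set E.Groupoid} (hU : IsCompactOpenBisection U)
    (hW : IsCompactOpenBisection W) (h : setMul U W = ∅) :
    oneOn S U hU * oneOn S W hW = 0 := by
  refine Subtype.ext ((ind_conv hU).trans ?_)
  rw [h]
  exact Set.indicator_empty _

theorem ind_vertex {v : V} (h : E.IsRegular v) :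
    ind S (Z (vertex E v) (vertex E v)) = ∑ e ∈ h.2.toFinset, ind S (Z (edge E e) (edge E e)) := by
  have hZ : ∀ (e : Ed) (g : E.Groupoid) (t : EdgeSeq Ed), E.src e = v →
      (IsTail (edge E e) (edge E e) g t ↔ IsTail (vertex E v) (vertex E v) g (cons e t)) := by
    rintro e g t rfl
    exact isTail_append (α := vertex E (E.src e)) (β := vertex E (E.src e)) (m := [e])
      (ha := ⟨rfl, trivial⟩) (hb := ⟨rfl, trivial⟩)
  funext g
  rw [Finset.sum_apply]
  by_cases hg : g ∈ Z (vertex E v) (vertex E v)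
  · obtain ⟨t, ht⟩ := (mem_Z rfl).1 hg
    rcases eq_nil_or_cons t with rfl | ⟨e, t', rfl⟩
    · have := ht.isBoundary
      rcases this.2 with h' | h'
      · exact absurd h' h.1.ne_empty
      · exact absurd h.2 h'
    · have he : E.src e = v := (isBoundary_cons.1 ht.isBoundary).1
      rw [Finset.sum_eq_single_of_mem e (h.2.mem_toFinset.2 he)]
      · rw [ind, ind, Set.indicator_of_mem hg,
          Set.indicator_of_mem ((mem_Z rfl).2 ⟨t', (hZ e g t' he).2 ht⟩)]
      · intro f hf hfe
        refine Set.indicator_of_notMem ?_ _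
        intro hgf
        obtain ⟨u, hu⟩ := (mem_Z rfl).1 hgf
        rw [hZ f g u (h.2.mem_toFinset.1 hf)] at hu
        exact hfe (cons_inj (hu.unique ht)).1
  · rw [ind, Set.indicator_of_notMem hg]
    refine (Finset.sum_eq_zero fun e he => Set.indicator_of_notMem ?_ _).symm
    intro hge
    obtain ⟨u, hu⟩ := (mem_Z rfl).1 hge
    rw [hZ e g u (h.2.mem_toFinset.1 he)] at hu
    exact hg ((mem_Z rfl).2 ⟨_, hu⟩)

theorem coe_sum {ι : Type*} (s : Finset ι) (f : ι → E.SteinbergAlgebra S) :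
    (∑ i ∈ s, f i).1 = ∑ i ∈ s, (f i).1 :=
  map_sum (steinbergSubmodule E S).subtype f s

theorem freeHom_rel {a b : FreeAlg V Ed S} (h : LeavittRel E S a b) :
    freeHom E S a = freeHom E S b := by
  cases h with
  | vertex_self v =>
    rw [map_mul, freeHom_genOf]
    have h := isBis_vertex E v
    exact oneOn_mul E S h h h (Z_mul_Z rfl rfl)
  | vertex_ne v v' h =>
    rw [map_mul, map_zero, freeHom_genOf, freeHom_genOf]
    refine oneOn_mul_zero E S (isBis_vertex E v) (isBis_vertex E v')
      (Set.eq_empty_iff_forall_notMem.2 ?_)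
    rintro _ ⟨a, ha, b, hb, hab, rfl⟩
    obtain ⟨t, ht⟩ := (mem_Z rfl).1 ha
    obtain ⟨t', ht'⟩ := (mem_Z rfl).1 hb
    exact h (ht.ss.symm.trans ((congrArg BoundaryPath.start hab).trans ht'.rs))
  | src_edge e =>
    rw [map_mul, freeHom_genOf, freeHom_genOf]
    exact oneOn_mul E S (isBis_vertex E _) (isBis_edge E e) (isBis_edge E e)
      (Z_src_edge E e)
  | edge_rng e =>
    rw [map_mul, freeHom_genOf, freeHom_genOf]
    exact oneOn_mul E S (isBis_edge E e) (isBis_vertex E _) (isBis_edge E e)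
      (Z_mul_Z rfl rfl)
  | rng_ghost e =>
    rw [map_mul, freeHom_genOf, freeHom_genOf]
    exact oneOn_mul E S (isBis_vertex E _) (isBis_ghost E e) (isBis_ghost E e)
      (Z_mul_Z rfl rfl)
  | ghost_src e =>
    rw [map_mul, freeHom_genOf, freeHom_genOf]
    exact oneOn_mul E S (isBis_ghost E e) (isBis_vertex E _) (isBis_ghost E e)
      (Z_ghost_src E e)
  | ghost_edge_self e =>
    rw [map_mul, freeHom_genOf, freeHom_genOf, freeHom_genOf]
    exact oneOn_mul E S (isBis_ghost E e) (isBis_edge E e) (isBis_vertex E _)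
      (Z_mul_Z rfl rfl)
  | ghost_edge_ne e f h =>
    rw [map_mul, map_zero, freeHom_genOf, freeHom_genOf]
    refine oneOn_mul_zero E S (isBis_ghost E e) (isBis_edge E f)
      (Set.eq_empty_iff_forall_notMem.2 ?_)
    rintro _ ⟨a, ha, b, hb, hab, rfl⟩
    obtain ⟨t, ht⟩ := (mem_Z (α := vertex E (E.rng e)) (β := edge E e) rfl).1 ha
    obtain ⟨t', ht'⟩ := (mem_Z (α := edge E f) (β := vertex E (E.rng f)) rfl).1 hb
    exact h (cons_inj (ht.se.symm.trans ((congrArg BoundaryPath.seq hab).trans ht'.re))).1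
  | regular v h =>
    rw [map_sum, freeHom_genOf]
    refine Subtype.ext ((ind_vertex E S h).trans ?_)
    rw [coe_sum]
    refine Finset.sum_congr rfl fun e _ => ?_
    rw [map_mul, freeHom_genOf, freeHom_genOf]
    have h1 : (edge E e).range = (vertex E (E.rng e)).range := rfl
    have h2 : (edge E e).range = (edge E e).range := rfl
    exact (congrArg Subtype.val (oneOn_mul E S (isBis_edge E e)
      (isBis_ghost E e) (isCompactOpenBisection_Z h2)
      (Z_mul_Z h1 h1.symm))).symm

theorem freeHom_con {a b : FreeAlg V Ed S} (h : leavittCon E S a b) :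
    freeHom E S a = freeHom E S b := by
  change RingConGen.Rel _ a b at h
  induction h with
  | of x y h =>
    obtain ⟨s, a', b', h, rfl, rfl⟩ := h
    rw [map_smul, map_smul, freeHom_rel E S h]
  | refl x => rfl
  | symm _ ih => exact ih.symm
  | trans _ _ ih ih' => exact ih.trans ih'
  | add _ _ ih ih' => rw [map_add, map_add, ih, ih']
  | mul _ _ ih ih' => rw [map_mul, map_mul, ih, ih']

/-- The natural homomorphism `π_E : L_S(E) → A_S(𝒢_E)`. -/
noncomputable def naturalHom : E.LeavittPathAlgebra S →ₙₐ[S] E.SteinbergAlgebra S where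
  toFun := Quotient.lift (s := (leavittCon E S).toSetoid) (freeHom E S)
    fun _ _ h => freeHom_con E S h
  map_smul' s x := by
    obtain ⟨a, rfl⟩ := leavittMk_surjective E S x
    exact map_smul (freeHom E S) s a
  map_zero' := map_zero (freeHom E S)
  map_add' x y := by
    obtain ⟨a, rfl⟩ := leavittMk_surjective E S x
    obtain ⟨b, rfl⟩ := leavittMk_surjective E S y
    exact map_add (freeHom E S) a b
  map_mul' x y := by
    obtain ⟨a, rfl⟩ := leavittMk_surjective E S x
    obtain ⟨b, rfl⟩ := leavittMk_surjective E S y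
    exact map_mul (freeHom E S) a b

theorem naturalHom_gen (x : Gen V Ed) : naturalHom E S (leavittGen x) = genImage E S x :=
  freeHom_genOf E S x

end Algebras

end DirectedGraph

end GraphAlg

/-!
The range of `π_E` is the `S`-span of the functions `1_{Z(α, β)}` (`range_naturalHom`): a product
of two cylinders `Z(α, β) Z(γ, δ)` is empty or again a cylinder, and every cylinder is a product of
the cylinders attached to vertices, edges and ghost edges. Since `1 + 1 = 1` in `S`, the
characteristic function of a finite union, disjoint or not, is the sum of the characteristic
functions.

If `E` is row-finite, the cylinders form a basis of the topology (`isTopologicalBasis_Z`), because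
a boundary path of length zero then starts at a sink and the filters `F` in `Z(α, β, F)` are not
needed. So a compact open set is a finite union of cylinders, and its characteristic function is in
the range.

If `v` is an infinite emitter, the vertex `v` is itself a boundary path, and the only cylinder that
contains the unit at `v` is `Z(v, v)`. Hence every `f` in the range satisfies `f(v) ≤ f(g)` for all
`g ∈ Z(v, v)`, where `a ≤ b` means `a + b = b` (`apply_unit_add_apply`). For an edge `e` emitted by
`v`, this fails for the characteristic function of `Z(v, v, {e})`, which is `1` at `v` and `0` at
the arrows of the nonempty set `Z(e, e)`.
-/

namespace GraphAlg

namespace DirectedGraph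

open EdgeSeq Groupoid FinPath

universe u v w

variable {V : Type u} {Ed : Type v} {E : DirectedGraph V Ed}

/-! ### Products of cylinders -/

theorem setMul_Z_append {α β δ : E.FinPath} (m : List Ed) (ha : E.IsWalk α.range m)
    (hb : E.IsWalk β.range m) (h : α.range = β.range) (h' : (β.append m hb).range = δ.range) :
    setMul (Z α β) (Z (β.append m hb) δ) = Z (α.append m ha) δ := by
  have := mul_longer (ha := ha) (hb := hb) h h' ∅ ∅ (by simp)
  have hr : restFilter (∅ : Finset Ed) m = ∅ := Finset.subset_empty.1 (restFilter_subset ∅ m)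
  simp only [ZF_empty, hr] at this
  rw [this, Z_mul_Z (range_append_congr h) h']

theorem setMul_Z_of_append {α β γ δ : E.FinPath} (h : α.range = β.range) (h' : γ.range = δ.range)
    {m : List Ed} (hs : γ.start = β.start) (he : γ.edges = β.edges ++ m) :
    ∃ ε ζ : E.FinPath, ε.range = ζ.range ∧ setMul (Z α β) (Z γ δ) = Z ε ζ := by
  obtain ⟨hb, rfl⟩ := FinPath.eq_append hs he
  have ha : E.IsWalk α.range m := by rwa [h]
  exact ⟨α.append m ha, δ, (range_append_congr h).trans h', setMul_Z_append m ha hb h h'⟩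

theorem setMul_Z_eq_empty_or {α β γ δ : E.FinPath} (h : α.range = β.range)
    (h' : γ.range = δ.range) : setMul (Z α β) (Z γ δ) = ∅ ∨
      ∃ ε ζ : E.FinPath, ε.range = ζ.range ∧ setMul (Z α β) (Z γ δ) = Z ε ζ := by
  rcases Set.eq_empty_or_nonempty (setMul (Z α β) (Z γ δ)) with hne | ⟨_, a, hA, b, hB, hab, rfl⟩
  · exact Or.inl hne
  right
  obtain ⟨t, ht⟩ := (mem_Z h).1 hA
  obtain ⟨t', ht'⟩ := (mem_Z h').1 hB
  have hs : γ.start = β.start := by rw [← ht'.rs, ← hab, ht.ss]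
  have hp : prepend β.edges t = prepend γ.edges t' := by rw [← ht.se, hab, ht'.re]
  rcases prepend_eq_prepend hp with ⟨m, hm, -⟩ | ⟨m, hm, -⟩
  · exact setMul_Z_of_append h h' hs hm
  · -- The other case is the first one for the inverse sets.
    obtain ⟨ε, ζ, hr, he⟩ := setMul_Z_of_append h'.symm h.symm hs.symm hm
    refine ⟨ζ, ε, hr.symm, ?_⟩
    rw [← setInv_Z E hr, ← he, setInv_setMul, setInv_Z E h.symm, setInv_Z E h'.symm]

/-! ### The range of the natural homomorphism -/

section Range

variable (E) (S : Type w) [CommSemiring S]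

/-- The `S`-span of the characteristic functions `1_{Z(α, β)}` in the Steinberg algebra. -/
noncomputable def cylinderSpan : Submodule S (E.SteinbergAlgebra S) :=
  Submodule.span S {f | ∃ (α β : E.FinPath) (h : α.range = β.range),
    f = oneOn S (Z α β) (isCompactOpenBisection_Z h)}

variable {E} in
theorem oneOn_Z_mem_cylinderSpan {α β : E.FinPath} (h : α.range = β.range) :
    oneOn S (Z α β) (isCompactOpenBisection_Z h) ∈ cylinderSpan E S :=
  Submodule.subset_span ⟨α, β, h, rfl⟩

variable {E S} in
theorem mul_mem_cylinderSpan {f g : E.SteinbergAlgebra S} (hf : f ∈ cylinderSpan E S)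
    (hg : g ∈ cylinderSpan E S) : f * g ∈ cylinderSpan E S := by
  induction hf, hg using Submodule.span_induction₂ with
  | mem_mem x y hx hy =>
    obtain ⟨α, β, h, rfl⟩ := hx
    obtain ⟨γ, δ, h', rfl⟩ := hy
    rcases setMul_Z_eq_empty_or h h' with he | ⟨ε, ζ, hr, he⟩
    · rw [oneOn_mul_zero E S _ _ he]
      exact zero_mem _
    · rw [oneOn_mul E S _ _ (isCompactOpenBisection_Z hr) he]
      exact oneOn_Z_mem_cylinderSpan S hr
  | zero_left y hy => rw [zero_mul]; exact zero_mem _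
  | zero_right x hx => rw [mul_zero]; exact zero_mem _
  | add_left x y z hx hy hz h1 h2 => rw [add_mul]; exact add_mem h1 h2
  | add_right x y z hx hy hz h1 h2 => rw [mul_add]; exact add_mem h1 h2
  | smul_left r x y hx hy h => rw [smul_mul_assoc]; exact Submodule.smul_mem _ r h
  | smul_right r x y hx hy h => rw [mul_smul_comm]; exact Submodule.smul_mem _ r h

theorem genImage_mem_cylinderSpan (x : Gen V Ed) : genImage E S x ∈ cylinderSpan E S := by
  cases x with
  | vertex v => exact oneOn_Z_mem_cylinderSpan S (α := vertex E v) rfl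
  | edge e => exact oneOn_Z_mem_cylinderSpan S (α := edge E e) (β := vertex E (E.rng e)) rfl
  | ghost e => exact oneOn_Z_mem_cylinderSpan S (α := vertex E (E.rng e)) (β := edge E e) rfl

theorem freeHom_mem_cylinderSpan (a : FreeAlg V Ed S) : freeHom E S a ∈ cylinderSpan E S := by
  have hw : ∀ w : FreeSemigroup (Gen V Ed),
      freeHom E S (MonoidAlgebra.single w 1) ∈ cylinderSpan E S := by
    intro w
    induction w using FreeSemigroup.recOnMul with
    | ih1 x =>
      change freeHom E S (genOf x) ∈ _
      rw [freeHom_genOf]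
      exact genImage_mem_cylinderSpan E S x
    | ih2 x y hx hy =>
      rw [← one_mul (1 : S), ← MonoidAlgebra.single_mul_single, map_mul]
      exact mul_mem_cylinderSpan hx hy
  induction a using MonoidAlgebra.induction_linear with
  | zero => rw [map_zero]; exact zero_mem _
  | add f g hf hg => rw [map_add]; exact add_mem hf hg
  | single w s =>
    rw [← mul_one s, ← smul_eq_mul, ← MonoidAlgebra.smul_single, map_smul]
    exact Submodule.smul_mem _ s (hw w)

theorem genImage_mem_range (x : Gen V Ed) :
    genImage E S x ∈ NonUnitalAlgHom.range (naturalHom E S) :=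
  ⟨leavittGen x, naturalHom_gen E S x⟩

variable {E} in
theorem setMul_Z_edge (e : Ed) {l : List Ed} (hl : E.IsWalk (E.rng e) l)
    (hel : E.IsWalk (E.src e) (e :: l)) {β : E.FinPath}
    (h : (⟨E.rng e, l, hl⟩ : E.FinPath).range = β.range) :
    setMul (Z (edge E e) (vertex E (E.rng e))) (Z ⟨E.rng e, l, hl⟩ β) =
      Z ⟨E.src e, e :: l, hel⟩ β :=
  setMul_Z_append (α := edge E e) (β := vertex E (E.rng e)) l hl hl rfl h

variable {E} in
theorem setMul_Z_ghost (e : Ed) {l : List Ed} (hl : E.IsWalk (E.rng e) l)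
    (hel : E.IsWalk (E.src e) (e :: l)) {α : E.FinPath}
    (h : α.range = (⟨E.rng e, l, hl⟩ : E.FinPath).range) :
    setMul (Z α ⟨E.rng e, l, hl⟩) (Z (vertex E (E.rng e)) (edge E e)) =
      Z α ⟨E.src e, e :: l, hel⟩ := by
  have h' : α.range = (⟨E.src e, e :: l, hel⟩ : E.FinPath).range := h
  have he : (vertex E (E.rng e)).range = (edge E e).range := rfl
  rw [← setInv_Z E h.symm, ← setInv_Z E he.symm, ← setInv_setMul,
    setMul_Z_edge e hl hel h.symm, setInv_Z E h'.symm]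

variable {E} in
/-- The edges of `α` and of `β` are stripped off one by one, by
`Z(e α, β) = Z(e, r(e)) Z(α, β)` and `Z(α, e β) = Z(α, β) Z(r(e), e)`, which leaves the cylinder
of a vertex. -/
theorem oneOn_Z_mem_range {α β : E.FinPath} (h : α.range = β.range) :
    oneOn S (Z α β) (isCompactOpenBisection_Z h) ∈ NonUnitalAlgHom.range (naturalHom E S) := by
  obtain ⟨a, l, hl⟩ := α
  induction l generalizing a with
  | nil =>
    obtain ⟨b, m, hm⟩ := β
    induction m generalizing b with
    | nil =>
      obtain rfl : a = b := h
      exact genImage_mem_range E S (.vertex a)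
    | cons f m ih =>
      obtain rfl : E.src f = b := hm.1
      have := mul_mem (ih _ hm.2 h) (genImage_mem_range E S (.ghost f))
      rwa [genImage, oneOn_mul E S _ _ (isCompactOpenBisection_Z h) (setMul_Z_ghost f hm.2 _ h)]
        at this
  | cons e l ih =>
    obtain rfl : E.src e = a := hl.1
    have := mul_mem (genImage_mem_range E S (.edge e)) (ih _ hl.2 h)
    rwa [genImage, oneOn_mul E S _ _ (isCompactOpenBisection_Z h) (setMul_Z_edge e hl.2 _ h)]
      at this

theorem range_naturalHom :
    (NonUnitalAlgHom.range (naturalHom E S)).toSubmodule = cylinderSpan E S := by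
  apply le_antisymm
  · rintro _ ⟨x, rfl⟩
    obtain ⟨a, rfl⟩ := leavittMk_surjective E S x
    exact freeHom_mem_cylinderSpan E S a
  · refine Submodule.span_le.2 ?_
    rintro _ ⟨α, β, h, rfl⟩
    exact oneOn_Z_mem_range S h

theorem surjective_naturalHom_iff :
    Function.Surjective (naturalHom E S) ↔ ∀ f, f ∈ cylinderSpan E S := by
  simp only [← range_naturalHom]
  rfl

end Range

/-! ### Row-finite graphs -/

variable (E) in
/-- The cylinders `Z(α, β)` with `r(α) = r(β)`. -/
def cylinders : Set (Set E.Groupoid) :=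
  {U | ∃ α β : E.FinPath, α.range = β.range ∧ U = Z α β}

theorem isTopologicalBasis_Z (hE : E.RowFinite) :
    TopologicalSpace.IsTopologicalBasis (cylinders E) := by
  refine TopologicalSpace.isTopologicalBasis_of_isOpen_of_nhds ?_ ?_
  · rintro _ ⟨α, β, h, rfl⟩
    exact isOpen_Z h
  intro g U hg hU
  obtain ⟨_, ⟨α, β, F, h, hF, rfl⟩, hgB, hB⟩ :=
    isTopologicalBasis_basicSets.isOpen_iff.1 hU g hg
  obtain ⟨t, ht, htF⟩ := (mem_ZF h).1 hgB
  rcases eq_nil_or_cons t with rfl | ⟨e, t, rfl⟩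
  · -- The tail is empty, so `r(α)` is a sink and `F` is empty.
    have hsink : E.out α.range = ∅ := ht.isBoundary.2.resolve_right fun h' => h' (hE _)
    rw [hsink] at hF
    obtain rfl : F = ∅ := by simpa using hF
    rw [ZF_empty] at hB
    exact ⟨Z α β, ⟨α, β, h, rfl⟩, (mem_Z h).2 ⟨_, ht⟩, hB⟩
  · have ha : E.IsWalk α.range [e] := ⟨(isBoundary_cons.1 ht.isBoundary).1, trivial⟩
    have hb : E.IsWalk β.range [e] := ⟨(isBoundary_cons.1 ht.isBoundary').1, trivial⟩
    refine ⟨Z (α.append [e] ha) (β.append [e] hb), ⟨_, _, range_append_congr h, rfl⟩,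
      (mem_Z (range_append_congr h)).2 ⟨t, isTail_append.2 ht⟩, fun k hk => hB ?_⟩
    obtain ⟨u, hu⟩ := (mem_Z (range_append_congr h)).1 hk
    refine (mem_ZF h).2 ⟨_, isTail_append.1 hu, fun f hf t' ht' => ?_⟩
    obtain ⟨rfl, -⟩ := cons_inj ht'
    exact htF e hf t rfl

variable {S : Type w} [CommSemiring S]

theorem ind_union (h1 : (1 : S) + 1 = 1) (A B : Set E.Groupoid) :
    ind S (A ∪ B) = ind S A + ind S B := by
  funext g
  by_cases hA : g ∈ A <;> by_cases hB : g ∈ B <;> simp [ind, hA, hB, h1]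

theorem ind_sUnion_mem (h1 : (1 : S) + 1 = 1) (N : Submodule S (E.Groupoid → S))
    {A : Set (Set E.Groupoid)} (hA : A.Finite) (h : ∀ U ∈ A, ind S U ∈ N) :
    ind S (⋃₀ A) ∈ N := by
  induction A, hA using Set.Finite.induction_on with
  | empty =>
    rw [Set.sUnion_empty, show ind S (∅ : Set E.Groupoid) = 0 from Set.indicator_empty _]
    exact zero_mem _
  | insert _ _ ih =>
    rw [Set.sUnion_insert, ind_union h1]
    exact add_mem (h _ (Set.mem_insert _ _)) (ih fun U hU => h U (Set.mem_insert_of_mem _ hU))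

theorem mem_cylinderSpan_of_rowFinite (h1 : (1 : S) + 1 = 1) (hE : E.RowFinite)
    (f : E.SteinbergAlgebra S) : f ∈ cylinderSpan E S := by
  let N : Submodule S (E.Groupoid → S) :=
    (cylinderSpan E S).map (steinbergSubmodule E S).subtype
  have hN : steinbergSubmodule E S ≤ N := by
    refine Submodule.span_le.2 ?_
    rintro _ ⟨U, hU, rfl⟩
    obtain ⟨s, rfl⟩ := eq_sUnion_finset_of_isTopologicalBasis_of_isCompact_open _
      (isTopologicalBasis_Z hE) U hU.isCompact hU.isOpen
    refine ind_sUnion_mem h1 N (s.finite_toSet.image _) ?_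
    rintro _ ⟨⟨_, α, β, h, rfl⟩, -, rfl⟩
    exact ⟨_, oneOn_Z_mem_cylinderSpan S h, rfl⟩
  obtain ⟨f', hf', he⟩ := hN f.2
  obtain rfl : f' = f := Subtype.ext he
  exact hf'

/-! ### Graphs with an infinite emitter -/

variable (E) in
/-- Every vertex is the start of a boundary path. -/
theorem exists_isBoundary (v : V) : ∃ t, E.IsBoundary v t := by
  by_contra hv
  -- A vertex that starts no boundary path is not a sink, and each of its edges leads to such a
  -- vertex again; following these edges gives an infinite path.
  have hstep : ∀ w : {w : V // ¬ ∃ t, E.IsBoundary w t}, ∃ e, E.src e = w.1 ∧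
      ¬ ∃ t, E.IsBoundary (E.rng e) t := by
    rintro ⟨w, hw⟩
    have hne : E.out w ≠ ∅ := fun h => hw ⟨fin [], trivial, Or.inl h⟩
    obtain ⟨e, he⟩ := Set.nonempty_iff_ne_empty.2 hne
    exact ⟨e, he, fun ⟨t, ht⟩ => hw ⟨cons e t, isBoundary_cons.2 ⟨he, ht⟩⟩⟩
  choose nxt hsrc hrng using hstep
  let p : ℕ → {w : V // ¬ ∃ t, E.IsBoundary w t} :=
    fun n => Nat.rec ⟨v, hv⟩ (fun _ w => ⟨E.rng (nxt w), hrng w⟩) n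
  exact hv ⟨inf fun n => nxt (p n), hsrc (p 0), fun i => (hsrc (p (i + 1))).symm⟩

/-- The infinite emitter `v` as a boundary path of length zero. -/
def vertexBoundary (v : V) (hv : E.IsInfiniteEmitter v) : E.BoundaryPath :=
  ⟨v, fin [], trivial, Or.inr hv⟩

theorem prepend_eq_nil {l : List Ed} {t : EdgeSeq Ed} (h : prepend l t = fin []) : l = [] := by
  cases l with
  | nil => rfl
  | cons e l => exact absurd h (cons_ne_nil _ _)

/-- `Z(v, v)` is the only cylinder that contains the unit at an infinite emitter `v`. -/
theorem eq_vertex_of_unit_mem_Z {v : V} (hv : E.IsInfiniteEmitter v) {α β : E.FinPath}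
    (h : α.range = β.range) (hu : unit (vertexBoundary v hv) ∈ Z α β) :
    α = vertex E v ∧ β = vertex E v := by
  obtain ⟨t, ht⟩ := (mem_Z h).1 hu
  exact ⟨FinPath.ext ht.rs.symm (prepend_eq_nil ht.re.symm),
    FinPath.ext ht.ss.symm (prepend_eq_nil ht.se.symm)⟩

/-- In the natural order of the additively idempotent semiring `S`, where `a ≤ b` means
`a + b = b`, the value of `f` at the unit of an infinite emitter `v` is the least one on
`Z(v, v)`. The equation, unlike the implication `f(v) ≠ 0 → f(g) ≠ 0`, passes to multiples of `f`
when `S` has zero divisors. -/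
theorem apply_unit_add_apply (h1 : (1 : S) + 1 = 1) {v : V} (hv : E.IsInfiniteEmitter v)
    {g : E.Groupoid} (hg : g ∈ Z (vertex E v) (vertex E v)) {f : E.SteinbergAlgebra S}
    (hf : f ∈ cylinderSpan E S) : f.1 (unit (vertexBoundary v hv)) + f.1 g = f.1 g := by
  induction hf using Submodule.span_induction with
  | mem f hf =>
    obtain ⟨α, β, h, rfl⟩ := hf
    by_cases hu : unit (vertexBoundary v hv) ∈ Z α β
    · obtain ⟨rfl, rfl⟩ := eq_vertex_of_unit_mem_Z hv h hu
      simp [oneOn, ind, hu, hg, h1]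
    · simp [oneOn, ind, hu]
  | zero => exact add_zero (0 : S)
  | add f f' _ _ hf hf' =>
    change f.1 _ + f'.1 _ + (f.1 g + f'.1 g) = f.1 g + f'.1 g
    rw [add_add_add_comm, hf, hf']
  | smul s f _ hf =>
    change s * f.1 _ + s * f.1 g = s * f.1 g
    rw [← mul_add, hf]

theorem rowFinite_of_forall_mem_cylinderSpan [Nontrivial S] (h1 : (1 : S) + 1 = 1)
    (h : ∀ f, f ∈ cylinderSpan E S) : E.RowFinite := by
  intro v
  by_contra hv
  obtain ⟨e, he⟩ := Set.Infinite.nonempty hv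
  obtain ⟨t, ht⟩ := exists_isBoundary E (E.rng e)
  have hb : E.IsBoundary (vertex E v).range (cons e t) := isBoundary_cons.2 ⟨he, ht⟩
  have hU : ZF (vertex E v) (vertex E v) {e} ∈ basicSets E :=
    ⟨vertex E v, vertex E v, {e}, rfl, Finset.coe_singleton e ▸ Set.singleton_subset_iff.2 he, rfl⟩
  have hg := isTail_arrow rfl hb
  have key := apply_unit_add_apply h1 hv ((mem_Z rfl).2 ⟨_, hg⟩)
    (h (oneOn S _ (isCompactOpenBisection_basicSets hU)))
  have hu : unit (vertexBoundary v hv) ∈ ZF (vertex E v) (vertex E v) {e} := by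
    refine (mem_ZF rfl).2 ⟨fin [], ⟨rfl, rfl, rfl, rfl, (sub_self _).symm⟩, ?_⟩
    exact fun f _ t' => (cons_ne_nil f t').symm
  have hgU : arrow (vertex E v) (vertex E v) rfl (cons e t) hb ∉
      ZF (vertex E v) (vertex E v) {e} := by
    intro hgU
    obtain ⟨t', ht', hF⟩ := (mem_ZF rfl).1 hgU
    exact hF e (Finset.mem_singleton_self e) t (ht'.unique hg)
  simp [oneOn, ind, hu, hgU] at key

end DirectedGraph

end GraphAlg

open GraphAlg.DirectedGraph in
theorem mainTheorem7 {V Ed : Type*} (E : GraphAlg.DirectedGraph V Ed) (S : Type*)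
    [CommSemiring S] [Nontrivial S] (hS : ∀ a : S, a + a = a) :
    Function.Surjective (GraphAlg.DirectedGraph.naturalHom E S) ↔ E.RowFinite := by
  rw [surjective_naturalHom_iff]
  exact ⟨rowFinite_of_forall_mem_cylinderSpan (hS 1), mem_cylinderSpan_of_rowFinite (hS 1)⟩
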